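/- For a measurable $K$ on $\mathbb R$ with $K(u)|u|^{-1/2}\in L^1(\mathbb R)$ let $\mathcal H_K$ be the (bounded) Hausdorff operator $(\mathcal H_Kf)(x)=\int_{\mathbb R}K(u)f(ux)\,du$ on the complex space $L^2(\mathbb R)$. For $\alpha>0$ let $H_\alpha$ be the Hölder mean $$(H_\alpha f)(x)=\frac1{\Gamma(\alpha)}\int_0^1\Bigl(\log\frac1u\Bigr)^{\alpha-1}f(ux)\,du ,\qquad f\in L^2(\mathbb R),$$ and $H_0=I$; thus $H_1=\mathcal C$ is the Cesàro operator $(\mathcal Cf)(x)=\int_0^1f(ux)\,du$. Then $(H_\alpha)_{\alpha\ge0}$ is a $C_0$-semigroup on $L^2(\mathbb R)$. Let $\log\mathcal C$ denote its (unbounded) generator and $R(\lambda,\log\mathcal C)=(\lambda-\log\mathcal C)^{-1}$ its resolvent. For $w\in\mathbb C$ put $$\nu(e^{w},-1)=\int_0^\infty\frac{e^{w(t-1)}}{\Gamma(t)}\,dt,$$ that is, $\nu(y,-1)=\int_0^\infty y^{t-1}\,dt/\Gamma(t)$ regarded as a function on the Riemann surface of the logarithm. For $0<u<1$ the point $e^{-\lambda}\log\frac1u$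 is taken with the logarithm $-\lambda+\log\log\frac1u$, so that $(e^{-\lambda}\log\frac1u)^{t-1}=e^{-\lambda(t-1)}(\log\frac1u)^{t-1}$. Below, $\log$ of a complex number in the right half-plane is the principal logarithm. (i) Every $\lambda$ with $\operatorname{Re}\lambda>\log2$ is a regular point of $\log\mathcal C$, and $R(\lambda,\log\mathcal C)$ is the Hausdorff operator $\mathcal H_K$ with $K(u)=e^{-\lambda}\nu(e^{-\lambda}\log\frac1u,-1)$ for $0<u<1$ and $K(u)=0$ otherwise. That is, $K(u)|u|^{-1/2}\in L^1(\mathbb R)$ and, for every $f\in L^2(\mathbb R)$ and almost every $x\in\mathbb R$, $$R(\lambda,\log\mathcal C)f(x)=e^{-\lambda}\int_0^1\nu\Bigl(e^{-\lambda}\log\frac1u,-1\Bigr)f(ux)\,du ,$$ with an absolutely convergent integral. (ii) If $\operatorname{Re}\lambda>\log2$, then $$\sigma(R(\lambda,\log\mathcal C))=\Bigl\{\frac1{\lambda+\log(\frac12-is)}:s\in\mathbb R\Bigr\}\cup\{0\}.$$ (iii) The spectrum of $\log\mathcal C$ equals its continuous spectrum and is the curve $$\sigma(\log\mathcal C)=\Bigl\{\log(2\cos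 y)+iy:\ y\in\Bigl(-\frac\pi2,\frac\pi2\Bigr)\Bigr\};$$ in particular $\sup\{\operatorname{Re}\lambda:\lambda\in\sigma(\log\mathcal C)\}=\log2$. (iv) Each real $\lambda\ne\log2$ is a regular point of $\log\mathcal C$, and $$\|R(\lambda,\log\mathcal C)\|=\frac1{\lambda-\log2}\quad(\lambda>\log2),\qquad \lim_{\lambda\to-\infty}\|R(\lambda,\log\mathcal C)\|=\frac2\pi .$$ -/

import Mathlib

open MeasureTheory Filter Topology
open scoped ENNReal

namespace CesaroLog

noncomputable section

/-- The complex Hilbert space `L²(ℝ)`. -/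
abbrev L2R : Type := Lp ℂ 2 (volume : Measure ℝ)

/-- `K(u)|u|^{-1/2} ∈ L¹(ℝ)`. -/
def IsHausdorffKernel (K : ℝ → ℂ) : Prop :=
  Integrable (fun u : ℝ => K u * ((|u| ^ (-(1 / 2) : ℝ) : ℝ) : ℂ))

/-- The function `x ↦ ∫ K(u) f(ux) du`. -/
def hausdorffFun (K f : ℝ → ℂ) (x : ℝ) : ℂ := ∫ u, K u * f (u * x)

lemma lintegral_comp_mul (g : ℝ → ℝ≥0∞) (hg : Measurable g) {u : ℝ} (hu : u ≠ 0) :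
    ∫⁻ x, g (u * x) = ENNReal.ofReal |u⁻¹| * ∫⁻ x, g x := by
  have h := lintegral_map (μ := volume) hg (measurable_const_mul u)
  rw [Real.map_volume_mul_left hu, lintegral_smul_measure] at h
  rw [← h, smul_eq_mul]

lemma lintegral_sq_le (k g : ℝ → ℝ≥0∞) (hk : Measurable k) (hg : Measurable g) :
    ∫⁻ x, (∫⁻ u, k u * g (u * x)) ^ 2 ≤
      (∫⁻ u, k u * ENNReal.ofReal (|u| ^ (-(1 / 2) : ℝ))) ^ 2 * ∫⁻ x, g x ^ 2 := by
  set C := ∫⁻ u, k u * ENNReal.ofReal (|u| ^ (-(1 / 2) : ℝ)) with hC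
  have hae : ∀ᵐ u : ℝ, u ≠ 0 := by simp [ae_iff]
  have key : ∀ x, (∫⁻ u, k u * g (u * x)) ^ 2 ≤
      C * ∫⁻ u, k u * ENNReal.ofReal (|u| ^ ((1 / 2) : ℝ)) * g (u * x) ^ 2 := by
    intro x
    set a : ℝ → ℝ≥0∞ := fun u => k u ^ (1 / 2 : ℝ) * ENNReal.ofReal (|u| ^ (-(1 / 4) : ℝ))
    set b : ℝ → ℝ≥0∞ := fun u =>
      k u ^ (1 / 2 : ℝ) * ENNReal.ofReal (|u| ^ ((1 / 4) : ℝ)) * g (u * x)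
    have ha : Measurable a := by fun_prop
    have hb : Measurable b := by fun_prop
    have hkk : ∀ u, k u ^ (1 / 2 : ℝ) * k u ^ (1 / 2 : ℝ) = k u := by
      intro u
      rw [← ENNReal.rpow_add_of_nonneg _ _ (by norm_num) (by norm_num)]; norm_num
    have h1 : ∫⁻ u, k u * g (u * x) = ∫⁻ u, (a * b) u := by
      apply lintegral_congr_ae
      filter_upwards [hae] with u hu
      have hu' : 0 < |u| := abs_pos.mpr hu
      have : ENNReal.ofReal (|u| ^ (-(1 / 4) : ℝ)) * ENNReal.ofReal (|u| ^ ((1 / 4) : ℝ)) = 1 := by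
        rw [← ENNReal.ofReal_mul (by positivity), ← Real.rpow_add hu']; norm_num
      calc k u * g (u * x) = (k u ^ (1 / 2 : ℝ) * k u ^ (1 / 2 : ℝ)) * 1 * g (u * x) := by
            rw [hkk, mul_one]
        _ = _ := by rw [← this]; simp only [a, b, Pi.mul_apply]; ring
    have h2 : ∫⁻ u, a u ^ (2 : ℝ) = C := by
      apply lintegral_congr_ae
      filter_upwards [hae] with u hu
      have hu' : 0 < |u| := abs_pos.mpr hu
      have : ENNReal.ofReal (|u| ^ (-(1 / 4) : ℝ)) * ENNReal.ofReal (|u| ^ (-(1 / 4) : ℝ)) =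
          ENNReal.ofReal (|u| ^ (-(1 / 2) : ℝ)) := by
        rw [← ENNReal.ofReal_mul (by positivity), ← Real.rpow_add hu']; norm_num
      simp only [a, ENNReal.rpow_two, sq]
      rw [← this]
      nth_rewrite 3 [← hkk u]
      ring
    have h3 : ∫⁻ u, b u ^ (2 : ℝ) =
        ∫⁻ u, k u * ENNReal.ofReal (|u| ^ ((1 / 2) : ℝ)) * g (u * x) ^ 2 := by
      apply lintegral_congr_ae
      filter_upwards [hae] with u hu
      have hu' : 0 < |u| := abs_pos.mpr hu
      have : ENNReal.ofReal (|u| ^ ((1 / 4) : ℝ)) * ENNReal.ofReal (|u| ^ ((1 / 4) : ℝ)) =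
          ENNReal.ofReal (|u| ^ ((1 / 2) : ℝ)) := by
        rw [← ENNReal.ofReal_mul (by positivity), ← Real.rpow_add hu']; norm_num
      simp only [b, ENNReal.rpow_two, sq]
      rw [← this]
      nth_rewrite 3 [← hkk u]
      ring
    have := ENNReal.lintegral_mul_le_Lp_mul_Lq volume Real.HolderConjugate.two_two
      ha.aemeasurable hb.aemeasurable
    rw [h2, h3] at this
    rw [← h1] at this
    refine (pow_le_pow_left' this 2).trans_eq ?_
    rw [mul_pow, ← ENNReal.rpow_natCast, ← ENNReal.rpow_natCast, ← ENNReal.rpow_mul,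
      ← ENNReal.rpow_mul]
    norm_num
  calc ∫⁻ x, (∫⁻ u, k u * g (u * x)) ^ 2
      ≤ ∫⁻ x, C * ∫⁻ u, k u * ENNReal.ofReal (|u| ^ ((1 / 2) : ℝ)) * g (u * x) ^ 2 :=
        lintegral_mono key
    _ = C * ∫⁻ x, ∫⁻ u, k u * ENNReal.ofReal (|u| ^ ((1 / 2) : ℝ)) * g (u * x) ^ 2 := by
        refine lintegral_const_mul _ (Measurable.lintegral_prod_right'
          (f := fun p : ℝ × ℝ => k p.2 * ENNReal.ofReal (|p.2| ^ ((1 / 2) : ℝ)) *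
            g (p.2 * p.1) ^ 2) (by fun_prop))
    _ = C * ∫⁻ u, ∫⁻ x, k u * ENNReal.ofReal (|u| ^ ((1 / 2) : ℝ)) * g (u * x) ^ 2 := by
        rw [lintegral_lintegral_swap]; fun_prop
    _ = C * ∫⁻ u, (k u * ENNReal.ofReal (|u| ^ (-(1 / 2) : ℝ))) * ∫⁻ x, g x ^ 2 := by
        congr 1
        apply lintegral_congr_ae
        filter_upwards [hae] with u hu
        have hu' : 0 < |u| := abs_pos.mpr hu
        rw [lintegral_const_mul _ (by fun_prop),
          lintegral_comp_mul (fun y => g y ^ 2) (by fun_prop) hu, ← mul_assoc, mul_assoc (k u),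
          ← ENNReal.ofReal_mul (by positivity), abs_inv, ← Real.rpow_neg_one,
          ← Real.rpow_add hu']
        norm_num
    _ = C ^ 2 * ∫⁻ x, g x ^ 2 := by
        rw [lintegral_mul_const _ (by fun_prop), ← hC]; ring

lemma IsHausdorffKernel.aestronglyMeasurable {K : ℝ → ℂ} (hK : IsHausdorffKernel K) :
    AEStronglyMeasurable K volume := by
  have h : AEStronglyMeasurable (fun u : ℝ => ((|u| ^ ((1 / 2) : ℝ) : ℝ) : ℂ)) volume :=
    (by fun_prop : Measurable _).aestronglyMeasurable
  refine (AEStronglyMeasurable.mul (Integrable.aestronglyMeasurable hK) h).congr ?_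
  filter_upwards [show ∀ᵐ u : ℝ, u ≠ 0 by simp [ae_iff]] with u hu
  have hu' : 0 < |u| := abs_pos.mpr hu
  simp only [Pi.mul_apply]
  rw [mul_assoc, ← Complex.ofReal_mul, ← Real.rpow_add hu']
  norm_num

/-- The `L¹`-norm of `K(u)|u|^{-1/2}`. -/
def kernelMass (K : ℝ → ℂ) : ℝ≥0∞ := ∫⁻ u, ‖K u‖ₑ * ENNReal.ofReal (|u| ^ (-(1 / 2) : ℝ))

lemma IsHausdorffKernel.kernelMass_ne_top {K : ℝ → ℂ} (hK : IsHausdorffKernel K) :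
    kernelMass K ≠ ∞ := by
  have := hK.2.ne
  convert this using 1
  unfold kernelMass
  congr 1 with u
  rw [enorm_mul]
  congr 1
  rw [← ofReal_norm, Complex.norm_real, Real.norm_of_nonneg (by positivity)]

lemma hausdorff_lintegral_le {K f : ℝ → ℂ} (hK : IsHausdorffKernel K) (hf : Measurable f) :
    ∫⁻ x, (∫⁻ u, ‖K u * f (u * x)‖ₑ) ^ 2 ≤ kernelMass K ^ 2 * ∫⁻ x, ‖f x‖ₑ ^ 2 := by
  obtain ⟨K', hK', hKK'⟩ := hK.aestronglyMeasurable
  have h := lintegral_sq_le (fun u => ‖K' u‖ₑ) (fun x => ‖f x‖ₑ)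
    hK'.measurable.enorm hf.enorm
  have h1 : ∀ x, ∫⁻ u, ‖K u * f (u * x)‖ₑ = ∫⁻ u, ‖K' u‖ₑ * ‖f (u * x)‖ₑ := by
    intro x
    apply lintegral_congr_ae
    filter_upwards [hKK'] with u hu
    rw [hu, enorm_mul]
  have h2 : kernelMass K = ∫⁻ u, ‖K' u‖ₑ * ENNReal.ofReal (|u| ^ (-(1 / 2) : ℝ)) := by
    apply lintegral_congr_ae
    filter_upwards [hKK'] with u hu
    rw [hu]
  simp only [h1, h2]
  exact h

lemma eLpNorm_two_sq (f : ℝ → ℂ) : eLpNorm f 2 volume ^ 2 = ∫⁻ x, ‖f x‖ₑ ^ 2 := by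
  rw [eLpNorm_eq_lintegral_rpow_enorm_toReal (by norm_num) (by norm_num),
    ← ENNReal.rpow_natCast, ← ENNReal.rpow_mul]
  norm_num

lemma hausdorffFun_aestronglyMeasurable {K f : ℝ → ℂ} (hK : IsHausdorffKernel K)
    (hf : Measurable f) : AEStronglyMeasurable (hausdorffFun K f) volume := by
  have h : AEStronglyMeasurable (fun p : ℝ × ℝ => K p.2 * f (p.2 * p.1))
      (volume.prod volume) :=
    (hK.aestronglyMeasurable.comp_snd).mul
      (by fun_prop : Measurable fun p : ℝ × ℝ => f (p.2 * p.1)).aestronglyMeasurable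
  exact h.integral_prod_right'

lemma eLpNorm_hausdorffFun_le {K f : ℝ → ℂ} (hK : IsHausdorffKernel K) (hf : Measurable f) :
    eLpNorm (hausdorffFun K f) 2 volume ≤ kernelMass K * eLpNorm f 2 volume := by
  rw [← ENNReal.pow_le_pow_left_iff two_ne_zero, mul_pow, eLpNorm_two_sq, eLpNorm_two_sq]
  refine le_trans (lintegral_mono fun x => ?_) (hausdorff_lintegral_le hK hf)
  exact pow_le_pow_left' (enorm_integral_le_lintegral_enorm _) 2

lemma integrable_hausdorff {K f : ℝ → ℂ} (hK : IsHausdorffKernel K) (hf : Measurable f)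
    (hf2 : MemLp f 2 volume) : ∀ᵐ x : ℝ, Integrable (fun u => K u * f (u * x)) := by
  have hfin : ∫⁻ x, (∫⁻ u, ‖K u * f (u * x)‖ₑ) ^ 2 ≠ ∞ := by
    refine ((hausdorff_lintegral_le hK hf).trans_lt ?_).ne
    rw [← eLpNorm_two_sq]
    exact ENNReal.mul_lt_top (ENNReal.pow_lt_top hK.kernelMass_ne_top.lt_top)
      (ENNReal.pow_lt_top hf2.2)
  have hm : AEMeasurable (fun x => (∫⁻ u, ‖K u * f (u * x)‖ₑ) ^ 2) volume := by
    have h : AEStronglyMeasurable (fun p : ℝ × ℝ => K p.2 * f (p.2 * p.1))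
        (volume.prod volume) :=
      (hK.aestronglyMeasurable.comp_snd).mul
        (by fun_prop : Measurable fun p : ℝ × ℝ => f (p.2 * p.1)).aestronglyMeasurable
    exact (h.enorm.lintegral_prod_right').pow_const 2
  filter_upwards [ae_lt_top' hm hfin] with x hx
  refine ⟨hK.aestronglyMeasurable.mul (by fun_prop : Measurable _).aestronglyMeasurable, ?_⟩
  by_contra hcon
  rw [HasFiniteIntegral, not_lt, top_le_iff] at hcon
  rw [hcon] at hx
  simp at hx

lemma hausdorffFun_congr (K : ℝ → ℂ) {f g : ℝ → ℂ} (h : f =ᵐ[volume] g) :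
    hausdorffFun K f =ᵐ[volume] hausdorffFun K g := by
  filter_upwards [show ∀ᵐ u : ℝ, u ≠ 0 by simp [ae_iff]] with x hx
  apply integral_congr_ae
  have hq : Measure.QuasiMeasurePreserving (fun u : ℝ => u * x) volume volume := by
    refine ⟨by fun_prop, ?_⟩
    rw [Real.map_volume_mul_right hx]
    exact Measure.smul_absolutelyContinuous
  filter_upwards [hq.ae h] with u hu
  rw [hu]

lemma hausdorffFun_memLp {K : ℝ → ℂ} (hK : IsHausdorffKernel K) (f : L2R) :
    MemLp (hausdorffFun K f) 2 volume := by
  refine ⟨hausdorffFun_aestronglyMeasurable hK (Lp.stronglyMeasurable f).measurable, ?_⟩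
  refine (eLpNorm_hausdorffFun_le hK (Lp.stronglyMeasurable f).measurable).trans_lt ?_
  exact ENNReal.mul_lt_top hK.kernelMass_ne_top.lt_top (Lp.memLp f).2

/-- The bounded Hausdorff operator `(H_K f)(x) = ∫ K(u) f(ux) du` on `L²(ℝ)`. -/
def hausdorff (K : ℝ → ℂ) (hK : IsHausdorffKernel K) : L2R →L[ℂ] L2R :=
  LinearMap.mkContinuous
    { toFun := fun f => (hausdorffFun_memLp hK f).toLp (hausdorffFun K f)
      map_add' := fun f g => by
        rw [← MemLp.toLp_add, MemLp.toLp_eq_toLp_iff]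
        filter_upwards [hausdorffFun_congr K (Lp.coeFn_add f g),
          integrable_hausdorff hK (Lp.stronglyMeasurable f).measurable (Lp.memLp f),
          integrable_hausdorff hK (Lp.stronglyMeasurable g).measurable (Lp.memLp g)]
          with x h1 h2 h3
        rw [h1, Pi.add_apply]
        simp only [hausdorffFun, Pi.add_apply, mul_add]
        exact integral_add h2 h3
      map_smul' := fun c f => by
        rw [RingHom.id_apply, ← MemLp.toLp_const_smul, MemLp.toLp_eq_toLp_iff]
        filter_upwards [hausdorffFun_congr K (Lp.coeFn_smul c f)] with x h1
        rw [h1, Pi.smul_apply]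
        simp only [hausdorffFun, Pi.smul_apply, smul_eq_mul]
        rw [← integral_const_mul]
        congr 1 with u
        ring }
    (kernelMass K).toReal
    fun f => by
      simp only [LinearMap.coe_mk, AddHom.coe_mk, Lp.norm_def]
      rw [← ENNReal.toReal_mul]
      refine ENNReal.toReal_mono
        (ENNReal.mul_ne_top hK.kernelMass_ne_top (Lp.memLp f).2.ne) ?_
      rw [eLpNorm_congr_ae (MemLp.coeFn_toLp _)]
      exact eLpNorm_hausdorffFun_le hK (Lp.stronglyMeasurable f).measurable

lemma hausdorff_apply (K : ℝ → ℂ) (hK : IsHausdorffKernel K) (f : L2R) :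
    hausdorff K hK f =ᵐ[volume] fun x => ∫ u, K u * f (u * x) :=
  MemLp.coeFn_toLp (hausdorffFun_memLp hK f)

/-- The kernel `Γ(α)⁻¹ (log(1/u))^{α-1}`, `0 < u < 1`, of the Hölder mean `H_α`. -/
def holderKernel (α : ℝ) : ℝ → ℂ :=
  (Set.Ioo (0 : ℝ) 1).indicator
    fun u => (((Real.Gamma α)⁻¹ * (Real.log (1 / u)) ^ (α - 1) : ℝ) : ℂ)

lemma isHausdorffKernel_holderKernel {α : ℝ} (hα : 0 < α) :
    IsHausdorffKernel (holderKernel α) := by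
  have h0 : IntegrableOn (fun v : ℝ => v ^ (α - 1) * Real.exp (-(1 / 2) * v)) (Set.Ioi 0) := by
    have := integrableOn_rpow_mul_exp_neg_mul_rpow (p := 1) (s := α - 1) (b := 1 / 2)
      (by linarith) one_pos (by norm_num)
    simpa using this
  have himg : (fun v : ℝ => Real.exp (-v)) '' Set.Ioi 0 = Set.Ioo 0 1 := by
    ext u
    simp only [Set.mem_image, Set.mem_Ioi, Set.mem_Ioo]
    constructor
    · rintro ⟨v, hv, rfl⟩
      exact ⟨Real.exp_pos _, by simpa using hv⟩
    · rintro ⟨h1, h2⟩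
      exact ⟨-Real.log u, by simpa using Real.log_neg h1 h2, by simp [Real.exp_log h1]⟩
  have h1 : IntegrableOn (fun u : ℝ => (Real.log (1 / u)) ^ (α - 1) * u ^ (-(1 / 2) : ℝ))
      (Set.Ioo 0 1) := by
    rw [← himg, integrableOn_image_iff_integrableOn_abs_deriv_smul measurableSet_Ioi
      (f' := fun v => -Real.exp (-v))]
    · refine h0.congr_fun (fun v hv => ?_) measurableSet_Ioi
      have : Real.exp (-v) ^ (-(1 / 2) : ℝ) = Real.exp (v / 2) := by
        rw [← Real.exp_mul]; ring_nf
      simp only [smul_eq_mul, one_div, ← Real.exp_neg, Real.log_exp, neg_neg, abs_neg,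
        Real.abs_exp] at this ⊢
      rw [this, mul_left_comm, ← Real.exp_add]
      ring_nf
    · intro v _
      have h := (Real.hasDerivAt_exp (-v)).comp v (hasDerivAt_neg v)
      rw [mul_neg_one] at h
      exact h.hasDerivWithinAt
    · intro a _ b _ hab
      simpa using hab
  have h2 : IntegrableOn (fun u : ℝ => (((Real.Gamma α)⁻¹ *
      ((Real.log (1 / u)) ^ (α - 1) * u ^ (-(1 / 2) : ℝ)) : ℝ) : ℂ)) (Set.Ioo 0 1) :=
    (h1.const_mul _).ofReal
  unfold IsHausdorffKernel
  refine ((integrable_indicator_iff measurableSet_Ioo).2 h2).congr (ae_of_all _ fun u => ?_)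
  by_cases hu : u ∈ Set.Ioo (0 : ℝ) 1
  · simp only [holderKernel, Set.indicator_of_mem hu, abs_of_pos hu.1]
    push_cast
    ring
  · simp [holderKernel, Set.indicator_of_notMem hu]

/-- The Hölder means, with `H_0 = I`. -/
def holderMean (α : ℝ) : L2R →L[ℂ] L2R :=
  if hα : 0 < α then hausdorff (holderKernel α) (isHausdorffKernel_holderKernel hα) else 1


/-- `H_1` is the Cesàro operator. -/
lemma holderMean_one_apply (f : L2R) :
    holderMean 1 f =ᵐ[volume] fun x => ∫ u in Set.Ioo (0 : ℝ) 1, f (u * x) := by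
  rw [holderMean, dif_pos one_pos]
  refine (hausdorff_apply _ _ f).trans (ae_of_all _ fun x => ?_)
  simp only [← integral_indicator measurableSet_Ioo]
  congr 1 with u
  by_cases hu : u ∈ Set.Ioo (0 : ℝ) 1 <;> simp [holderKernel, hu]

section Unbounded

variable {E : Type*} [NormedAddCommGroup E] [NormedSpace ℂ E]

/-- `T`, restricted to `[0, ∞)`, is a strongly continuous one-parameter semigroup. -/
structure IsC0Semigroup (T : ℝ → E →L[ℂ] E) : Prop where
  zero : T 0 = 1
  add : ∀ s t : ℝ, 0 ≤ s → 0 ≤ t → T (s + t) = T s * T t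
  tendsto_zero : ∀ f : E, Tendsto (fun t => T t f) (𝓝[>] 0) (𝓝 f)

/-- The (unbounded) infinitesimal generator: `A f = lim_{t → 0+} (T_t f - f) / t`, defined on the
subspace of those `f` for which the limit exists in norm. -/
def generator (T : ℝ → E →L[ℂ] E) : E →ₗ.[ℂ] E where
  domain :=
    { carrier := {f | ∃ g : E,
        Tendsto (fun t : ℝ => (t : ℂ)⁻¹ • (T t f - f)) (𝓝[>] 0) (𝓝 g)}
      zero_mem' := ⟨0, by simp⟩
      add_mem' := by
        rintro a b ⟨g, hg⟩ ⟨h, hh⟩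
        refine ⟨g + h, (hg.add hh).congr fun t => ?_⟩
        rw [← smul_add, map_add]
        congr 1
        abel
      smul_mem' := by
        rintro c a ⟨g, hg⟩
        refine ⟨c • g, (hg.const_smul c).congr fun t => ?_⟩
        rw [smul_comm, smul_sub, map_smul] }
  toFun :=
    { toFun := fun f => f.2.choose
      map_add' := fun a b => by
        refine tendsto_nhds_unique (a + b).2.choose_spec
          ((a.2.choose_spec.add b.2.choose_spec).congr fun t => ?_)
        rw [← smul_add, Submodule.coe_add, map_add]
        congr 1
        abel
      map_smul' := fun c a => by
        refine tendsto_nhds_unique (c • a).2.choose_spec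
          ((a.2.choose_spec.const_smul c).congr fun t => ?_)
        rw [smul_comm, smul_sub, Submodule.coe_smul, map_smul] }

lemma generator_spec (T : ℝ → E →L[ℂ] E) (f : (generator T).domain) :
    Tendsto (fun t : ℝ => (t : ℂ)⁻¹ • (T t f - f)) (𝓝[>] 0) (𝓝 (generator T f)) :=
  f.2.choose_spec

/-- `R` is a bounded two-sided inverse of `z - A : D(A) → E`. -/
def IsResolventAt (A : E →ₗ.[ℂ] E) (z : ℂ) (R : E →L[ℂ] E) : Prop :=
  (∀ f : A.domain, R (z • (f : E) - A f) = f) ∧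
    ∀ g : E, ∃ h : R g ∈ A.domain, z • R g - A ⟨R g, h⟩ = g

/-- The set of regular points of `A`. -/
def resolventSet (A : E →ₗ.[ℂ] E) : Set ℂ := {z | ∃ R : E →L[ℂ] E, IsResolventAt A z R}

/-- The spectrum of the unbounded operator `A`. -/
def spectrumOf (A : E →ₗ.[ℂ] E) : Set ℂ := (resolventSet A)ᶜ

/-- The continuous spectrum: `z - A` is injective, not onto, and has dense range. -/
def continuousSpectrum (A : E →ₗ.[ℂ] E) : Set ℂ :=
  {z | Function.Injective (fun f : A.domain => z • (f : E) - A f) ∧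
    ¬ Function.Surjective (fun f : A.domain => z • (f : E) - A f) ∧
    DenseRange (fun f : A.domain => z • (f : E) - A f)}

open Classical in
/-- The resolvent `R(z, A) = (z - A)⁻¹` for regular `z` (and `0` otherwise). -/
def resolventOp (A : E →ₗ.[ℂ] E) (z : ℂ) : E →L[ℂ] E :=
  if h : z ∈ resolventSet A then h.choose else 0

lemma resolventOp_spec {A : E →ₗ.[ℂ] E} {z : ℂ} (h : z ∈ resolventSet A) :
    IsResolventAt A z (resolventOp A z) := by
  rw [resolventOp, dif_pos h]
  exact h.choose_spec

end Unbounded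

/-- `log 𝒞`, the generator of the semigroup of Hölder means on `L²(ℝ)`. -/
def logCesaro : L2R →ₗ.[ℂ] L2R := generator holderMean

/-- `ν(y, -1) = ∫_0^∞ y^{t-1} / Γ(t) dt` at the point `y = e^w` of the Riemann surface of the
logarithm, where `y^{t-1} = e^{w(t-1)}`. -/
def nuExp (w : ℂ) : ℂ :=
  ∫ t in Set.Ioi (0 : ℝ), Complex.exp (w * ((t - 1 : ℝ) : ℂ)) / (Real.Gamma t : ℂ)

/-- With the principal logarithm one recovers `ν(y, -1)` with principal powers. -/
lemma nuExp_log {y : ℂ} (hy : y ≠ 0) :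
    nuExp (Complex.log y) =
      ∫ t in Set.Ioi (0 : ℝ), y ^ (((t - 1 : ℝ) : ℂ)) / (Real.Gamma t : ℂ) := by
  simp only [nuExp, Complex.cpow_def_of_ne_zero hy]

/-- `u ↦ ν(e^{-z} log(1/u), -1)`, `0 < u < 1`, extended by `0`; the point `e^{-z} log(1/u)` is taken
with the logarithm `-z + log log(1/u)`. -/
def nuKernel (z : ℂ) : ℝ → ℂ :=
  (Set.Ioo (0 : ℝ) 1).indicator
    fun u => nuExp (-z + (Real.log (Real.log (1 / u)) : ℂ))

end

end CesaroLog

namespace CesaroLog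

noncomputable section

lemma ae_eq_zero_of_integral_Ioi {φ : ℝ → ℂ} (hφ : Integrable φ) (h0 : ∫ t, φ t = 0)
    (h : ∀ r, ∫ t in Set.Ioi r, φ t = 0) : φ =ᵐ[volume] 0 := by
  refine ae_eq_zero_of_forall_setIntegral_eq_of_sigmaFinite
    (fun s _ _ => hφ.integrableOn) fun s hs _ => ?_
  refine MeasurableSpace.induction_on_inter (C := fun s _ => ∫ t in s, φ t = 0)
    ((BorelSpace.measurable_eq (α := ℝ)).trans (borel_eq_generateFrom_Ioi ℝ)) isPiSystem_Ioi
    (by simp) ?_ ?_ ?_ s hs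
  · rintro _ ⟨r, rfl⟩
    exact h r
  · intro t ht ih
    have := integral_add_compl ht hφ
    rwa [ih, h0, zero_add] at this
  · intro f hd hm ih
    rw [integral_iUnion hm hd hφ.integrableOn]
    simp [ih]

section Abstract

set_option linter.unusedSectionVars false

variable {H : Type*} [NormedAddCommGroup H] [InnerProductSpace ℂ H] [CompleteSpace H]

/-- A one-parameter group `V` for which every `e^{t/2} V t` is unitary, weakly measurable. -/
structure IsDilationGroup (V : ℝ → H →L[ℂ] H) : Prop where
  add : ∀ s t : ℝ, V (s + t) = V s * V t
  star_mul_self : ∀ t : ℝ, star (V t) * V t = (Real.exp (-t) : ℂ) • 1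
  mul_star_self : ∀ t : ℝ, V t * star (V t) = (Real.exp (-t) : ℂ) • 1
  measurable : ∀ f g : H, Measurable fun t => inner ℂ f (V t g)

/-- `T = ∫_0^∞ k(t) V t dt` in the weak sense. -/
def IsLaplace (V : ℝ → H →L[ℂ] H) (k : ℝ → ℂ) (T : H →L[ℂ] H) : Prop :=
  ∀ f g : H, inner ℂ f (T g) = ∫ t in Set.Ioi (0 : ℝ), k t * inner ℂ f (V t g)

lemma opNorm_le_of_inner_le {T : H →L[ℂ] H} {M : ℝ} (hM : 0 ≤ M)
    (h : ∀ f g : H, ‖inner ℂ f (T g)‖ ≤ M * ‖f‖ * ‖g‖) : ‖T‖ ≤ M := by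
  refine T.opNorm_le_bound hM fun g => ?_
  have h1 := h (T g) g
  rw [inner_self_eq_norm_sq_to_K] at h1
  simp only [Complex.coe_algebraMap, norm_pow, Complex.norm_real, norm_norm] at h1
  rcases eq_or_ne (‖T g‖) 0 with h0 | h0
  · rw [h0]; positivity
  · have hp : 0 < ‖T g‖ := lt_of_le_of_ne (norm_nonneg _) (Ne.symm h0)
    nlinarith

lemma inner_star_apply (T : H →L[ℂ] H) (f g : H) : inner ℂ f (star T g) = inner ℂ (T f) g := by
  rw [ContinuousLinearMap.star_eq_adjoint, ContinuousLinearMap.adjoint_inner_right]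

namespace IsDilationGroup

variable {V : ℝ → H →L[ℂ] H} (hV : IsDilationGroup V)
include hV

lemma inner_apply_apply (t : ℝ) (f g : H) :
    inner ℂ (V t f) (V t g) = (Real.exp (-t) : ℂ) * inner ℂ f g := by
  rw [← inner_star_apply, ← mul_apply_eq_comp, hV.star_mul_self]
  simp

lemma norm_apply (t : ℝ) (f : H) : ‖V t f‖ = Real.exp (-t / 2) * ‖f‖ := by
  have h := hV.inner_apply_apply t f f
  rw [inner_self_eq_norm_sq_to_K, inner_self_eq_norm_sq_to_K] at h
  simp only [Complex.coe_algebraMap] at h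
  have h' : ‖V t f‖ ^ 2 = (Real.exp (-t / 2) * ‖f‖) ^ 2 := by
    rw [mul_pow, ← Real.exp_nat_mul]
    have : ((2 : ℕ) : ℝ) * (-t / 2) = -t := by push_cast; ring
    rw [this]
    exact_mod_cast h
  exact (pow_left_inj₀ (norm_nonneg _) (by positivity) two_ne_zero).1 h'

lemma norm_inner_le (t : ℝ) (f g : H) :
    ‖inner ℂ f (V t g)‖ ≤ Real.exp (-t / 2) * (‖f‖ * ‖g‖) := by
  refine (norm_inner_le_norm _ _).trans_eq ?_
  rw [hV.norm_apply]; ring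

lemma norm_inner_le' {t : ℝ} (ht : 0 ≤ t) (f g : H) : ‖inner ℂ f (V t g)‖ ≤ ‖f‖ * ‖g‖ := by
  refine (hV.norm_inner_le t f g).trans (mul_le_of_le_one_left (by positivity) ?_)
  rw [Real.exp_le_one_iff]; linarith

lemma opNorm_le {t : ℝ} (ht : 0 ≤ t) : ‖V t‖ ≤ 1 := by
  refine (V t).opNorm_le_bound zero_le_one fun g => ?_
  rw [hV.norm_apply]
  gcongr
  rw [Real.exp_le_one_iff]; linarith

lemma star_isDilationGroup : IsDilationGroup fun t => star (V t) where
  add s t := by rw [add_comm, hV.add, star_mul]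
  star_mul_self t := by rw [star_star, hV.mul_star_self]
  mul_star_self t := by rw [star_star, hV.star_mul_self]
  measurable f g := by
    have h := (continuous_star.measurable.comp (hV.measurable g f))
    convert h using 2 with t
    rw [inner_star_apply]
    exact (inner_conj_symm _ _).symm

lemma commute (s t : ℝ) : V s * V t = V t * V s := by
  rw [← hV.add, add_comm, hV.add]

lemma inner_apply_apply_sub (s t : ℝ) (f g : H) :
    inner ℂ (V s f) (V t g) = (Real.exp (-s) : ℂ) * inner ℂ f (V (t - s) g) := by
  have : V t g = V s (V (t - s) g) := by
    rw [← mul_apply_eq_comp, ← hV.add]; simp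
  rw [this, hV.inner_apply_apply]

lemma integrableOn_mul {k : ℝ → ℂ}
    (hk : IntegrableOn (fun t => k t * (Real.exp (-t / 2) : ℂ)) (Set.Ioi 0)) (f g : H) :
    IntegrableOn (fun t => k t * inner ℂ f (V t g)) (Set.Ioi 0) := by
  have h : IntegrableOn (fun t => (inner ℂ f (V t g) * (Real.exp (t / 2) : ℂ)) *
      (k t * (Real.exp (-t / 2) : ℂ))) (Set.Ioi 0) := by
    refine Integrable.bdd_mul hk
      ((hV.measurable f g).mul (by fun_prop)).aestronglyMeasurable (c := ‖f‖ * ‖g‖)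
      (ae_of_all _ fun t => ?_)
    rw [norm_mul, Complex.norm_real, Real.norm_of_nonneg (Real.exp_pos _).le]
    calc _ ≤ (Real.exp (-t / 2) * (‖f‖ * ‖g‖)) * Real.exp (t / 2) := by
          gcongr; exact hV.norm_inner_le _ _ _
      _ = (Real.exp (-t / 2) * Real.exp (t / 2)) * (‖f‖ * ‖g‖) := by ring
      _ = _ := by rw [← Real.exp_add]; ring_nf; simp
  refine h.congr (ae_of_all _ fun t => ?_)
  have h1 : (Real.exp (t / 2) : ℂ) * (Real.exp (-t / 2) : ℂ) = 1 := by
    rw [← Complex.ofReal_mul, ← Real.exp_add]; ring_nf; simp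
  linear_combination (k t * inner ℂ f (V t g)) * h1

lemma integrableOn (f g : H) : IntegrableOn (fun t => inner ℂ f (V t g)) (Set.Ioi 0) := by
  have : IntegrableOn (fun t : ℝ => (1 : ℂ) * (Real.exp (-t / 2) : ℂ)) (Set.Ioi 0) := by
    have h := (integrableOn_exp_mul_Ioi (a := -(1 / 2)) (by norm_num) 0).ofReal (𝕜 := ℂ)
    refine h.congr (ae_of_all _ fun t => ?_)
    simp only [one_mul]
    congr 2
    ring_nf
  simpa using hV.integrableOn_mul this f g

variable {C : H →L[ℂ] H} (hC : IsLaplace V 1 C)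
include hC

lemma inner_cesaro (f g : H) : inner ℂ f (C g) = ∫ t in Set.Ioi (0 : ℝ), inner ℂ f (V t g) := by
  simpa using hC f g

lemma isLaplace_star : IsLaplace (fun t => star (V t)) 1 (star C) := by
  intro f g
  simp only [Pi.one_apply, one_mul, inner_star_apply]
  rw [← inner_conj_symm, hV.inner_cesaro hC, ← integral_conj]
  simp only [inner_conj_symm]

lemma inner_cesaro_left (f g : H) :
    inner ℂ (C f) g = ∫ t in Set.Ioi (0 : ℝ), inner ℂ (V t f) g := by
  have := hV.isLaplace_star hC f g
  simpa only [Pi.one_apply, one_mul, inner_star_apply] using this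

lemma commute_cesaro (r : ℝ) : V r * C = C * V r := by
  ext g
  refine ext_inner_left ℂ fun f => ?_
  simp only [mul_apply_eq_comp]
  have h1 : inner ℂ f (V r (C g)) = inner ℂ (star (V r) f) (C g) := by
    rw [← inner_star_apply, star_star]
  rw [h1, hV.inner_cesaro hC, hV.inner_cesaro hC]
  congr 1 with t
  rw [← inner_star_apply, star_star, ← mul_apply_eq_comp, hV.commute]
  rfl

lemma inner_apply_cesaro_Ioi (r : ℝ) (f g : H) :
    inner ℂ f (V r (C g)) = ∫ t in Set.Ioi r, inner ℂ f (V t g) := by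
  have h1 : inner ℂ f (V r (C g)) = inner ℂ (star (V r) f) (C g) := by
    rw [← inner_star_apply, star_star]
  rw [h1, hV.inner_cesaro hC]
  have h2 := (measurePreserving_add_left (volume : Measure ℝ) r).setIntegral_preimage_emb
    (measurableEmbedding_addLeft r) (fun t => inner ℂ f (V t g)) (Set.Ioi r)
  rw [Set.preimage_const_add_Ioi, sub_self] at h2
  rw [← h2]
  congr 1 with t
  rw [← inner_star_apply, star_star, ← mul_apply_eq_comp, ← hV.add]

lemma inner_apply_cesaro {r : ℝ} (hr : 0 ≤ r) (f g : H) :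
    inner ℂ f (V r (C g)) = inner ℂ f (C g) - ∫ t in Set.Ioc 0 r, inner ℂ f (V t g) := by
  rw [hV.inner_apply_cesaro_Ioi hC, hV.inner_cesaro hC, ← Set.Ioc_union_Ioi_eq_Ioi hr,
    setIntegral_union (Set.Ioc_disjoint_Ioi le_rfl) measurableSet_Ioi
      ((hV.integrableOn f g).mono_set Set.Ioc_subset_Ioi_self)
      ((hV.integrableOn f g).mono_set (Set.Ioi_subset_Ioi hr))]
  ring

lemma norm_apply_cesaro_sub_le {r : ℝ} (hr : 0 ≤ r) : ‖V r * C - C‖ ≤ r := by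
  refine opNorm_le_of_inner_le hr fun f g => ?_
  rw [sub_apply, inner_sub_right, mul_apply_eq_comp,
    hV.inner_apply_cesaro hC hr]
  rw [sub_sub_cancel_left, norm_neg]
  have := norm_setIntegral_le_of_norm_le_const (μ := volume) (s := Set.Ioc (0 : ℝ) r)
    (f := fun t => inner ℂ f (V t g)) (C := ‖f‖ * ‖g‖) (by simp)
    (fun t ht => hV.norm_inner_le' ht.1.le f g)
  rw [measureReal_def, Real.volume_Ioc, sub_zero, ENNReal.toReal_ofReal hr] at this
  linarith

lemma norm_apply_cesaro_sq_sub_le {r : ℝ} (hr : 0 ≤ r) :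
    ‖V r * C ^ 2 - C ^ 2 + (r : ℂ) • C‖ ≤ r ^ 2 := by
  refine opNorm_le_of_inner_le (by positivity) fun f g => ?_
  have h1 : inner ℂ f ((V r * C ^ 2 - C ^ 2 + (r : ℂ) • C) g) =
      - ∫ t in Set.Ioc 0 r, inner ℂ f ((V t * C - C) g) := by
    simp only [sub_apply, inner_sub_right, mul_apply_eq_comp,
      add_apply, inner_add_right, pow_two, smul_apply,
      inner_smul_right]
    rw [integral_sub ((hV.integrableOn f (C g)).mono_set Set.Ioc_subset_Ioi_self)
      (by simp), hV.inner_apply_cesaro hC hr, setIntegral_const, measureReal_def,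
      Real.volume_Ioc, sub_zero, ENNReal.toReal_ofReal hr]
    simp only [Complex.real_smul]
    ring
  rw [h1, norm_neg]
  have := norm_setIntegral_le_of_norm_le_const (μ := volume) (s := Set.Ioc (0 : ℝ) r)
    (f := fun t => inner ℂ f ((V t * C - C) g)) (C := r * (‖f‖ * ‖g‖)) (by simp)
    (fun t ht => by
      refine (norm_inner_le_norm _ _).trans ?_
      calc ‖f‖ * ‖(V t * C - C) g‖ ≤ ‖f‖ * (r * ‖g‖) := by
            gcongr
            exact (ContinuousLinearMap.le_opNorm _ _).trans (by
              gcongr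
              exact (hV.norm_apply_cesaro_sub_le hC ht.1.le).trans ht.2)
        _ = _ := by ring)
  rw [measureReal_def, Real.volume_Ioc, sub_zero, ENNReal.toReal_ofReal hr] at this
  linarith

lemma cesaro_injective [TopologicalSpace.SeparableSpace H] : Function.Injective C := by
  rw [injective_iff_map_eq_zero]
  intro f hf
  have h0 : ∀ h : H, (fun t => inner ℂ h ((Set.Ioi (0 : ℝ)).indicator (fun t => V t f) t))
      =ᵐ[volume] 0 := by
    intro h
    have he : (fun t => inner ℂ h ((Set.Ioi (0 : ℝ)).indicator (fun t => V t f) t)) =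
        (Set.Ioi (0 : ℝ)).indicator (fun t => inner ℂ h (V t f)) := by
      ext t
      by_cases ht : t ∈ Set.Ioi (0 : ℝ) <;> simp [ht]
    rw [he]
    refine ae_eq_zero_of_integral_Ioi
      ((integrable_indicator_iff measurableSet_Ioi).2 (hV.integrableOn h f)) ?_ fun r => ?_
    · rw [integral_indicator measurableSet_Ioi, ← hV.inner_cesaro hC, hf, inner_zero_right]
    · rw [setIntegral_indicator measurableSet_Ioi, Set.Ioi_inter_Ioi,
        ← hV.inner_apply_cesaro_Ioi hC, hf, map_zero, inner_zero_right]
  have h1 : ∀ᵐ t ∂(volume.restrict (Set.Ioi (0 : ℝ))), V t f = 0 := by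
    rw [ae_restrict_iff' measurableSet_Ioi]
    filter_upwards [ae_eq_zero_of_forall_inner h0] with t ht hm
    rwa [Set.indicator_of_mem hm] at ht
  have : (ae (volume.restrict (Set.Ioi (0 : ℝ)))).NeBot := by
    rw [ae_neBot]; simp [Measure.restrict_eq_zero]
  obtain ⟨t, ht⟩ := h1.exists
  have := hV.norm_apply t f
  rw [ht, norm_zero] at this
  have h2 := Real.exp_pos (-t / 2)
  exact norm_eq_zero.1 ((mul_eq_zero.1 this.symm).resolve_left h2.ne')

lemma star_mul_cesaro : star C * C = C + star C := by
  ext g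
  refine ext_inner_left ℂ fun f => ?_
  set μ : Measure ℝ := volume.restrict (Set.Ioi 0) with hμ
  set F : ℝ → ℝ → ℂ := fun t s => inner ℂ (V s f) (V t g) with hF
  have hFm : Measurable (Function.uncurry F) := by
    have : Function.uncurry F = fun p : ℝ × ℝ =>
        (Real.exp (-p.2) : ℂ) * inner ℂ f (V (p.1 - p.2) g) := by
      ext ⟨t, s⟩
      exact hV.inner_apply_apply_sub s t f g
    rw [this]
    have := (hV.measurable f g).comp (measurable_fst.sub (measurable_snd : Measurable
      (Prod.snd : ℝ × ℝ → ℝ)))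
    exact (by fun_prop : Measurable fun p : ℝ × ℝ => (Real.exp (-p.2) : ℂ)).mul this
  have hexp : Integrable (fun t : ℝ => Real.exp (-t / 2)) μ := by
    have h := integrableOn_exp_mul_Ioi (a := -(1 / 2)) (by norm_num) 0
    refine h.congr (ae_of_all _ fun t => ?_)
    ring_nf
  have hFi : Integrable (Function.uncurry F) (μ.prod μ) := by
    refine ((hexp.mul_prod hexp).mul_const (‖f‖ * ‖g‖)).mono' hFm.aestronglyMeasurable
      (ae_of_all _ fun p => ?_)
    refine (norm_inner_le_norm _ _).trans_eq ?_
    rw [hV.norm_apply, hV.norm_apply]; ring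
  set S : Set (ℝ × ℝ) := {p | p.1 < p.2} with hS
  have hSm : MeasurableSet S := measurableSet_lt measurable_fst measurable_snd
  have h1 : inner ℂ f ((star C * C) g) = ∫ p, Function.uncurry F p ∂(μ.prod μ) := by
    rw [mul_apply_eq_comp, inner_star_apply, hV.inner_cesaro hC, integral_prod _ hFi]
    congr 1 with t
    exact hV.inner_cesaro_left hC f (V t g)
  have h2 : ∫ p, S.indicator (Function.uncurry F) p ∂(μ.prod μ) = inner ℂ (C f) g := by
    rw [integral_prod _ (hFi.indicator hSm)]
    have h3 : ∀ t ∈ Set.Ioi (0 : ℝ), ∫ s, S.indicator (Function.uncurry F) (t, s) ∂μ =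
        (Real.exp (-t) : ℂ) * inner ℂ (C f) g := by
      intro t ht
      have : (fun s => S.indicator (Function.uncurry F) (t, s)) =
          (Set.Ioi t).indicator (F t) := by
        ext s
        by_cases hs : t < s <;> simp [Set.indicator, hS, hs]
      rw [this, hμ, setIntegral_indicator measurableSet_Ioi, Set.Ioi_inter_Ioi,
        max_eq_right (le_of_lt ht)]
      have h5 : inner ℂ (V t (C f)) (V t g) = ∫ s in Set.Ioi t, F t s := by
        rw [← inner_conj_symm, hV.inner_apply_cesaro_Ioi hC, ← integral_conj]
        simp only [inner_conj_symm, hF]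
      rw [← h5, hV.inner_apply_apply]
    rw [setIntegral_congr_fun measurableSet_Ioi h3, integral_mul_const]
    have := integral_exp_neg_Ioi 0
    rw [integral_complex_ofReal, this]
    simp
  have h3 : ∫ p, Sᶜ.indicator (Function.uncurry F) p ∂(μ.prod μ) = inner ℂ f (C g) := by
    rw [integral_prod_symm _ (hFi.indicator hSm.compl)]
    have h3 : ∀ s ∈ Set.Ioi (0 : ℝ), ∫ t, Sᶜ.indicator (Function.uncurry F) (t, s) ∂μ =
        (Real.exp (-s) : ℂ) * inner ℂ f (C g) := by
      intro s hs
      have : (fun t => Sᶜ.indicator (Function.uncurry F) (t, s)) =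
          (Set.Ici s).indicator (fun t => F t s) := by
        ext t
        by_cases hs : t < s
        · simp [Set.indicator, hS, hs]
        · simp [Set.indicator, hS, hs, not_lt.1 hs]
      rw [this, hμ, setIntegral_indicator measurableSet_Ici, Set.inter_eq_right.2
        (Set.Ici_subset_Ioi.2 hs), integral_Ici_eq_integral_Ioi, ← hV.inner_apply_apply,
        hV.inner_apply_cesaro_Ioi hC]
    rw [setIntegral_congr_fun measurableSet_Ioi h3, integral_mul_const]
    have := integral_exp_neg_Ioi 0
    rw [integral_complex_ofReal, this]
    simp
  rw [h1, add_apply, inner_add_right, inner_star_apply, ← h2, ← h3, ← integral_add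
    (hFi.indicator hSm.compl) (hFi.indicator hSm)]
  congr 1 with p
  exact (Set.indicator_compl_add_self_apply S _ p).symm

lemma mul_star_cesaro : C * star C = C + star C := by
  have := hV.star_isDilationGroup.star_mul_cesaro (hV.isLaplace_star hC)
  rwa [star_star, add_comm] at this

lemma isStarNormal_cesaro : IsStarNormal C :=
  ⟨by rw [Commute, SemiconjBy, hV.star_mul_cesaro hC, hV.mul_star_cesaro hC]⟩

lemma spectrum_cesaro_subset {z : ℂ} (hz : z ∈ spectrum ℂ C) : ‖z - 1‖ = 1 := by
  have hu : C - 1 ∈ unitary (H →L[ℂ] H) := by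
    rw [Unitary.mem_iff]
    constructor
    · have := hV.star_mul_cesaro hC
      simp only [star_sub, star_one, sub_mul, mul_sub, this, one_mul, mul_one]; abel
    · have := hV.mul_star_cesaro hC
      simp only [star_sub, star_one, sub_mul, mul_sub, this, one_mul, mul_one]; abel
  have h1 : z - 1 ∈ spectrum ℂ (C - 1) := by
    have := spectrum.sub_singleton_eq C (1 : ℂ)
    rw [map_one] at this
    rw [← this]
    exact ⟨z, hz, 1, rfl, rfl⟩
  exact spectrum.norm_eq_one_of_unitary hu h1

end IsDilationGroup
end Abstract

section Circle

lemma normSq_eq_of_circle {z : ℂ} (hz : ‖z - 1‖ = 1) : ‖z‖ ^ 2 = 2 * z.re := by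
  have h : Complex.normSq (z - 1) = 1 := by rw [Complex.normSq_eq_norm_sq, hz]; norm_num
  rw [← Complex.normSq_eq_norm_sq]
  simp only [Complex.normSq_apply, Complex.sub_re, Complex.sub_im, Complex.one_re,
    Complex.one_im] at h ⊢
  linarith

lemma norm_le_two_of_circle {z : ℂ} (hz : ‖z - 1‖ = 1) : ‖z‖ ≤ 2 := by
  calc ‖z‖ = ‖(z - 1) + 1‖ := by ring_nf
    _ ≤ ‖z - 1‖ + ‖(1 : ℂ)‖ := norm_add_le _ _
    _ = 2 := by rw [hz, norm_one]; norm_num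

lemma re_pos_of_circle {z : ℂ} (hz : ‖z - 1‖ = 1) (h0 : z ≠ 0) : 0 < z.re := by
  have := normSq_eq_of_circle hz
  have h1 : 0 < ‖z‖ ^ 2 := by positivity
  linarith

lemma inv_re_of_circle {z : ℂ} (hz : ‖z - 1‖ = 1) (h0 : z ≠ 0) : (z⁻¹).re = 1 / 2 := by
  have h1 := normSq_eq_of_circle hz
  have h2 := re_pos_of_circle hz h0
  rw [Complex.inv_re, Complex.normSq_eq_norm_sq, h1]
  field_simp

lemma norm_exp_neg_div_of_circle {z : ℂ} (hz : ‖z - 1‖ = 1) (h0 : z ≠ 0) (t : ℝ) :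
    ‖Complex.exp (-t / z)‖ = Real.exp (-t / 2) := by
  rw [Complex.norm_exp, div_eq_mul_inv, ← Complex.ofReal_neg, Complex.re_ofReal_mul,
    inv_re_of_circle hz h0]
  ring_nf

/-- `e^{-t/z} z²`, the symbol of `V t C²`. -/
def expSymbol (t : ℝ) (z : ℂ) : ℂ := Complex.exp (-t / z) * z ^ 2

lemma norm_expSymbol_le {z : ℂ} (hz : ‖z - 1‖ = 1) (t : ℝ) :
    ‖expSymbol t z‖ ≤ Real.exp (-t / 2) * ‖z‖ ^ 2 := by
  rcases eq_or_ne z 0 with rfl | h0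
  · simp [expSymbol]
  · rw [expSymbol, norm_mul, norm_exp_neg_div_of_circle hz h0, norm_pow]

lemma continuousOn_expSymbol :
    ContinuousOn (fun p : ℝ × ℂ => expSymbol p.1 p.2) {p | ‖p.2 - 1‖ = 1} := by
  rintro ⟨t, z⟩ hz
  rcases eq_or_ne z 0 with rfl | h0
  · have h1 : Tendsto (fun p : ℝ × ℂ => Real.exp (-p.1 / 2) * ‖p.2‖ ^ 2)
        (𝓝[{p | ‖p.2 - 1‖ = 1}] (t, 0)) (𝓝 0) := by
      have : ContinuousAt (fun p : ℝ × ℂ => Real.exp (-p.1 / 2) * ‖p.2‖ ^ 2) (t, 0) := by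
        fun_prop
      have h2 := this.tendsto.mono_left
        (nhdsWithin_le_nhds (s := {p : ℝ × ℂ | ‖p.2 - 1‖ = 1}))
      simpa using h2
    have h3 : expSymbol t 0 = 0 := by simp [expSymbol]
    rw [ContinuousWithinAt]
    simp only [h3]
    refine squeeze_zero_norm' ?_ h1
    filter_upwards [self_mem_nhdsWithin] with p hp
    exact norm_expSymbol_le hp _
  · refine ContinuousAt.continuousWithinAt ?_
    unfold expSymbol
    have : ContinuousAt (fun p : ℝ × ℂ => -(p.1 : ℂ) / p.2) (t, z) :=
      ContinuousAt.div (by fun_prop) (by fun_prop) h0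
    fun_prop

lemma continuousOn_expSymbol_right (t : ℝ) :
    ContinuousOn (expSymbol t) {z | ‖z - 1‖ = 1} :=
  continuousOn_expSymbol.comp (f := fun z : ℂ => (t, z)) (by fun_prop) fun _ hz => hz

lemma norm_exp_neg_sub_le {w : ℂ} (hw : 0 ≤ w.re) : ‖Complex.exp (-w) - 1 + w‖ ≤ 3 * ‖w‖ ^ 2 := by
  rcases le_total ‖w‖ 1 with h | h
  · have := Complex.norm_exp_sub_one_sub_id_le (x := -w) (by rwa [norm_neg])
    rw [sub_neg_eq_add, norm_neg] at this
    nlinarith [norm_nonneg w]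
  · calc _ ≤ ‖Complex.exp (-w)‖ + ‖(1 : ℂ)‖ + ‖w‖ :=
          (norm_add_le _ _).trans (by gcongr; exact norm_sub_le _ _)
      _ ≤ 1 + 1 + ‖w‖ := by
          gcongr
          · rw [Complex.norm_exp, Real.exp_le_one_iff, Complex.neg_re]; linarith
          · simp
      _ ≤ _ := by nlinarith

lemma norm_expSymbol_sub_le {z : ℂ} (hz : ‖z - 1‖ = 1) {r : ℝ} (hr : 0 ≤ r) :
    ‖expSymbol r z - z ^ 2 + r * z‖ ≤ 3 * r ^ 2 := by
  rcases eq_or_ne z 0 with rfl | h0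
  · simp [expSymbol]; positivity
  · have h1 : expSymbol r z - z ^ 2 + r * z =
        (Complex.exp (-(r / z)) - 1 + r / z) * z ^ 2 := by
      rw [expSymbol, neg_div]
      field_simp
    have h2 : 0 ≤ ((r : ℂ) / z).re := by
      rw [div_eq_mul_inv, Complex.re_ofReal_mul, inv_re_of_circle hz h0]; positivity
    rw [h1, norm_mul, norm_pow]
    calc _ ≤ 3 * ‖(r : ℂ) / z‖ ^ 2 * ‖z‖ ^ 2 := by gcongr; exact norm_exp_neg_sub_le h2
      _ = 3 * r ^ 2 := by
        rw [norm_div, Complex.norm_real, Real.norm_of_nonneg hr]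
        have : ‖z‖ ≠ 0 := norm_ne_zero_iff.2 h0
        field_simp

lemma expSymbol_mul (s t : ℝ) (z : ℂ) :
    expSymbol s z * expSymbol t z = z ^ 2 * expSymbol (s + t) z := by
  simp only [expSymbol]
  rw [show -((s + t : ℝ) : ℂ) / z = -s / z + -t / z by push_cast; ring, Complex.exp_add]
  ring

end Circle

/-- A map on `[0, T]` whose increments are bounded by the square of the step is constant. -/
lemma eq_of_dist_le_sq {E : Type*} [MetricSpace E] {Q : ℝ → E} {T M : ℝ} (hT : 0 ≤ T)
    (h : ∀ s r, 0 ≤ s → 0 ≤ r → s + r ≤ T → dist (Q s) (Q (s + r)) ≤ M * r ^ 2) : Q 0 = Q T := by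
  have key : ∀ n : ℕ, dist (Q 0) (Q T) ≤ M * T ^ 2 / (n + 1) := by
    intro n
    have hn : (0 : ℝ) < n + 1 := by positivity
    have := dist_le_range_sum_of_dist_le (f := fun i : ℕ => Q (i * (T / (n + 1)))) (n + 1)
      (d := fun _ => M * (T / (n + 1)) ^ 2) (fun {k} hk => by
        have hk' : (k : ℝ) + 1 ≤ n + 1 := by exact_mod_cast hk
        have h1 := h (k * (T / (n + 1))) (T / (n + 1)) (by positivity) (by positivity) (by
          calc (k : ℝ) * (T / (n + 1)) + T / (n + 1) = (k + 1) * (T / (n + 1)) := by ring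
            _ ≤ (n + 1) * (T / (n + 1)) := by gcongr
            _ = T := by field_simp)
        convert h1 using 3
        push_cast; ring)
    simp only [Nat.cast_zero, zero_mul, Finset.sum_const, Finset.card_range, nsmul_eq_mul] at this
    convert this using 1
    · congr 2
      push_cast; field_simp
    · push_cast; field_simp
  have hlim : Tendsto (fun n : ℕ => M * T ^ 2 / ((n : ℝ) + 1)) atTop (𝓝 0) := by
    have := (tendsto_one_div_add_atTop_nhds_zero_nat (𝕜 := ℝ)).const_mul (M * T ^ 2)
    simpa [div_eq_mul_inv] using this
  exact dist_le_zero.1 (ge_of_tendsto' hlim key)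

section Abstract

variable {H : Type*} [NormedAddCommGroup H] [InnerProductSpace ℂ H] [CompleteSpace H]

lemma denseRange_of_isStarNormal {N : H →L[ℂ] H} (hN : IsStarNormal N)
    (hi : Function.Injective N) : DenseRange N := by
  have h : N.rangeᗮ = ⊥ := by
    rw [ContinuousLinearMap.IsStarNormal.orthogonal_range hN]
    exact LinearMap.ker_eq_bot.2 hi
  have := (Submodule.topologicalClosure_eq_top_iff).2 h
  rw [DenseRange, dense_iff_closure_eq]
  have h2 := congrArg (fun S : Submodule ℂ H => (S : Set H)) this
  rwa [Submodule.topologicalClosure_coe, Submodule.top_coe] at h2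

lemma denseRange_sq_of_isStarNormal {N : H →L[ℂ] H} (hN : IsStarNormal N)
    (hi : Function.Injective N) : DenseRange (N ^ 2 : H →L[ℂ] H) := by
  have h1 := denseRange_of_isStarNormal hN hi
  have h2 : ⇑(N ^ 2 : H →L[ℂ] H) = N ∘ N := by
    ext g; simp [pow_two]
  rw [h2]
  exact h1.comp h1 N.continuous

lemma norm_cfc_apply_sq {C : H →L[ℂ] H} {ψ : ℂ → ℂ}
    (hψ : ContinuousOn ψ (spectrum ℂ C)) (g : H) :
    (‖cfc ψ C g‖ ^ 2 : ℂ) = inner ℂ g (cfc (fun z => star (ψ z) * ψ z) C g) := by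
  rw [cfc_mul (fun z => star (ψ z)) ψ C (hψ.star) hψ, cfc_star, mul_apply_eq_comp,
    inner_star_apply, inner_self_eq_norm_sq_to_K]
  simp

lemma norm_cfc_apply_le {C : H →L[ℂ] H} {χ ψ : ℂ → ℂ} {M : ℝ} (hM : 0 ≤ M)
    (hχ : ContinuousOn χ (spectrum ℂ C)) (hψ : ContinuousOn ψ (spectrum ℂ C))
    (h : ∀ z ∈ spectrum ℂ C, ‖χ z‖ ≤ M * ‖ψ z‖) (g : H) :
    ‖cfc χ C g‖ ≤ M * ‖cfc ψ C g‖ := by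
  set η : ℂ → ℂ := fun z => (Real.sqrt (M ^ 2 * ‖ψ z‖ ^ 2 - ‖χ z‖ ^ 2) : ℂ) with hη
  have hηc : ContinuousOn η (spectrum ℂ C) := by
    refine Complex.continuous_ofReal.comp_continuousOn (Real.continuous_sqrt.comp_continuousOn ?_)
    exact (continuousOn_const.mul (hψ.norm.pow 2)).sub (hχ.norm.pow 2)
  have hsum : (M ^ 2 * ‖cfc ψ C g‖ ^ 2 : ℂ) = ‖cfc χ C g‖ ^ 2 + ‖cfc η C g‖ ^ 2 := by
    rw [norm_cfc_apply_sq hψ, norm_cfc_apply_sq hχ, norm_cfc_apply_sq hηc,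
      ← inner_add_right, ← add_apply, ← cfc_add C (fun z => star (χ z) * χ z)
        (fun z => star (η z) * η z) (hχ.star.mul hχ) (hηc.star.mul hηc)]
    rw [show (M ^ 2 : ℂ) = ((M ^ 2 : ℝ) : ℂ) by push_cast; rfl, ← inner_smul_right,
      ← smul_apply, ← cfc_const_mul _ (fun z => star (ψ z) * ψ z) _ (hψ.star.mul hψ)]
    congr 2
    refine cfc_congr fun z hz => ?_
    have h1 : ∀ w : ℂ, star w * w = ((‖w‖ ^ 2 : ℝ) : ℂ) := fun w => by
      rw [Complex.star_def, Complex.conj_mul']; push_cast; rfl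
    have h2 : 0 ≤ M ^ 2 * ‖ψ z‖ ^ 2 - ‖χ z‖ ^ 2 := by
      have := pow_le_pow_left₀ (norm_nonneg _) (h z hz) 2
      rw [mul_pow] at this
      linarith
    simp only [h1, hη, Complex.norm_real, Real.norm_eq_abs, sq_abs, Real.sq_sqrt h2]
    push_cast; ring
  have hsum' : M ^ 2 * ‖cfc ψ C g‖ ^ 2 = ‖cfc χ C g‖ ^ 2 + ‖cfc η C g‖ ^ 2 := by
    exact_mod_cast hsum
  refine le_of_sq_le_sq ?_ (by positivity)
  rw [mul_pow]
  nlinarith [sq_nonneg ‖cfc η C g‖]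

/-- Bounded symbols converging uniformly after multiplication by `z²` converge strongly. -/
lemma tendsto_cfc_apply {C : H →L[ℂ] H} (hN : IsStarNormal C) (hi : Function.Injective C)
    {ι : Type*} {l : Filter ι} {φ : ι → ℂ → ℂ} {ψ : ℂ → ℂ} {M : ℝ} {ε : ι → ℝ}
    (hφ : ∀ᶠ t in l, ContinuousOn (φ t) (spectrum ℂ C)) (hψ : ContinuousOn ψ (spectrum ℂ C))
    (hM : ∀ᶠ t in l, ∀ z ∈ spectrum ℂ C, ‖φ t z‖ ≤ M)
    (hε : Tendsto ε l (𝓝 0))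
    (hd : ∀ᶠ t in l, ∀ z ∈ spectrum ℂ C, ‖φ t z - ψ z‖ * ‖z‖ ^ 2 ≤ ε t) (g : H) :
    Tendsto (fun t => cfc (φ t) C g) l (𝓝 (cfc ψ C g)) := by
  have hdense : DenseRange (C ^ 2 : H →L[ℂ] H) :=
    denseRange_sq_of_isStarNormal hN hi
  set B := max M 0 + ‖cfc ψ C‖ with hB
  have hB0 : 0 ≤ B := by positivity
  rw [Metric.tendsto_nhds]
  intro δ hδ
  obtain ⟨_, ⟨f, rfl⟩, hf⟩ := Metric.mem_closure_iff.1 (hdense g) (δ / 2 / (B + 1)) (by positivity)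
  have h3 : Tendsto (fun t => ε t * ‖f‖) l (𝓝 0) := by simpa using hε.mul_const ‖f‖
  filter_upwards [hφ, hM, hd, h3.eventually (gt_mem_nhds (half_pos hδ))] with t h1 h2 hd' h3
  have hz : ∀ z ∈ spectrum ℂ C, ‖(φ t z - ψ z) * z ^ 2‖ ≤ ‖φ t z - ψ z‖ * ‖z‖ ^ 2 := fun z _ => by
    rw [norm_mul, norm_pow]
  have h4 : ‖(cfc (φ t) C - cfc ψ C) ((C ^ 2) f)‖ ≤ ε t * ‖f‖ := by
    have he : (cfc (φ t) C - cfc ψ C) * C ^ 2 = cfc (fun z => (φ t z - ψ z) * z ^ 2) C := by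
      rw [cfc_mul (fun z => φ t z - ψ z) (fun z => z ^ 2) C (h1.sub hψ) (by fun_prop),
        cfc_sub _ _ C h1 hψ, cfc_pow_id C]
    rw [← mul_apply_eq_comp, he]
    refine (ContinuousLinearMap.le_opNorm _ _).trans ?_
    rcases (spectrum ℂ C).eq_empty_or_nonempty with he | ⟨z, hz0⟩
    · have : ∀ z ∈ spectrum ℂ C, ‖(φ t z - ψ z) * z ^ 2‖ ≤ 0 := by simp [he]
      have h5 := norm_cfc_le le_rfl this
      have h6 : ‖f‖ = 0 ∨ 0 ≤ ε t := by
        left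
        rcases subsingleton_or_nontrivial H with hs | hn
        · rw [Subsingleton.elim f 0, norm_zero]
        · exact absurd he (spectrum.nonempty C).ne_empty
      rcases h6 with h6 | h6
      · rw [h6]; simp
      · gcongr; exact h5.trans h6
    · gcongr
      refine norm_cfc_le ?_ fun z hz' => (hz z hz').trans (hd' z hz')
      exact (by positivity : 0 ≤ ‖φ t z - ψ z‖ * ‖z‖ ^ 2).trans (hd' z hz0)
  have h5 : ‖cfc (φ t) C - cfc ψ C‖ ≤ B := by
    refine (norm_sub_le _ _).trans ?_
    rw [hB]; gcongr
    exact norm_cfc_le (le_max_right _ _) fun z hz' => (h2 z hz').trans (le_max_left _ _)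
  rw [dist_eq_norm, ← sub_apply]
  have h6 : ‖g - (C ^ 2) f‖ * (B + 1) < δ / 2 := by
    rw [dist_eq_norm, lt_div_iff₀ (by positivity)] at hf
    exact hf
  calc ‖(cfc (φ t) C - cfc ψ C) g‖
      = ‖(cfc (φ t) C - cfc ψ C) (g - (C ^ 2) f) + (cfc (φ t) C - cfc ψ C) ((C ^ 2) f)‖ := by
        rw [← map_add, sub_add_cancel]
    _ ≤ B * ‖g - (C ^ 2) f‖ + ε t * ‖f‖ := by
        refine (norm_add_le _ _).trans (add_le_add ?_ h4)
        exact (ContinuousLinearMap.le_opNorm _ _).trans (by gcongr)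
    _ < δ := by nlinarith [norm_nonneg (g - (C ^ 2) f)]

namespace IsDilationGroup

variable {V : ℝ → H →L[ℂ] H} (hV : IsDilationGroup V) {C : H →L[ℂ] H} (hC : IsLaplace V 1 C)
include hV

lemma apply_zero : V 0 = 1 := by
  have h1 : V 0 * V 0 = V 0 := by rw [← hV.add, add_zero]
  have h2 := hV.mul_star_self 0
  simp only [neg_zero, Real.exp_zero, Complex.ofReal_one, one_smul] at h2
  calc V 0 = V 0 * (V 0 * star (V 0)) := by rw [h2, mul_one]
    _ = 1 := by rw [← mul_assoc, h1, h2]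

include hC

lemma apply_mul_sq_eq_cfc [TopologicalSpace.SeparableSpace H] {T : ℝ} (hT : 0 ≤ T) :
    V T * C ^ 2 = cfc (expSymbol T) C := by
  have hN := hV.isStarNormal_cesaro hC
  have hσ : spectrum ℂ C ⊆ {z | ‖z - 1‖ = 1} := fun z hz => hV.spectrum_cesaro_subset hC hz
  have hcont : ∀ t, ContinuousOn (expSymbol t) (spectrum ℂ C) := fun t =>
    (continuousOn_expSymbol_right t).mono hσ
  have hsq : C ^ 2 = cfc (fun z : ℂ => z ^ 2) C := (cfc_pow_id C 2).symm
  have hstep : ∀ r, 0 ≤ r → ‖V r * C ^ 2 - cfc (expSymbol r) C‖ ≤ 4 * r ^ 2 := by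
    intro r hr
    have h1 := hV.norm_apply_cesaro_sq_sub_le hC hr
    have h2 : ‖cfc (expSymbol r) C - C ^ 2 + (r : ℂ) • C‖ ≤ 3 * r ^ 2 := by
      have he : cfc (expSymbol r) C - C ^ 2 + (r : ℂ) • C =
          cfc (fun z => expSymbol r z - z ^ 2 + r * z) C := by
        rw [cfc_add C (fun z => expSymbol r z - z ^ 2) (fun z => r * z)
          ((hcont r).sub (by fun_prop)) (by fun_prop), cfc_sub _ _ C (hcont r) (by fun_prop),
          cfc_const_mul _ _ C (by fun_prop), cfc_pow_id C, cfc_id' ℂ C]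
      rw [he]
      exact norm_cfc_le (by positivity) fun z hz => norm_expSymbol_sub_le (hσ hz) hr
    have h3 : V r * C ^ 2 - cfc (expSymbol r) C = (V r * C ^ 2 - C ^ 2 + (r : ℂ) • C) -
        (cfc (expSymbol r) C - C ^ 2 + (r : ℂ) • C) := by abel
    rw [h3]
    refine (norm_sub_le _ _).trans ?_
    linarith
  have hQ := eq_of_dist_le_sq (Q := fun s => V s * C ^ 2 * cfc (expSymbol (T - s)) C) (M := 16) hT
    (fun s r hs hr hsr => by
      have h1 : C ^ 2 * cfc (expSymbol (T - s)) C =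
          cfc (expSymbol r) C * cfc (expSymbol (T - (s + r))) C := by
        rw [hsq, ← cfc_mul _ _ _ (by fun_prop) (hcont _), ← cfc_mul _ _ _ (hcont _) (hcont _)]
        refine cfc_congr fun z _ => ?_
        simp only [expSymbol_mul]
        congr 2
        ring
      have h2 : V s * C ^ 2 * cfc (expSymbol (T - s)) C -
          V (s + r) * C ^ 2 * cfc (expSymbol (T - (s + r))) C =
          -(V s * ((V r * C ^ 2 - cfc (expSymbol r) C) * cfc (expSymbol (T - (s + r))) C)) := by
        rw [mul_assoc, h1, hV.add]
        noncomm_ring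
      rw [dist_eq_norm, h2, norm_neg]
      have h3 : ‖cfc (expSymbol (T - (s + r))) C‖ ≤ 4 := by
        refine norm_cfc_le (by norm_num) fun z hz => (norm_expSymbol_le (hσ hz) _).trans ?_
        have h4 : Real.exp (-(T - (s + r)) / 2) ≤ 1 := by
          rw [Real.exp_le_one_iff]; linarith
        have h5 : ‖z‖ ^ 2 ≤ 2 ^ 2 := by gcongr; exact norm_le_two_of_circle (hσ hz)
        calc _ ≤ 1 * (2 : ℝ) ^ 2 := by gcongr
          _ = 4 := by norm_num
      calc _ ≤ ‖V s‖ * (‖V r * C ^ 2 - cfc (expSymbol r) C‖ *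
              ‖cfc (expSymbol (T - (s + r))) C‖) :=
            (norm_mul_le _ _).trans (by gcongr; exact norm_mul_le _ _)
        _ ≤ 1 * (4 * r ^ 2 * 4) := by
            gcongr
            · exact hV.opNorm_le hs
            · exact hstep r hr
        _ = 16 * r ^ 2 := by ring)
  have h0 : cfc (expSymbol 0) C = C ^ 2 := by
    rw [hsq]
    exact cfc_congr fun z _ => by simp [expSymbol]
  simp only [sub_zero, sub_self, h0, hV.apply_zero, one_mul] at hQ
  have hcomm : V T * C ^ 2 * C ^ 2 = C ^ 2 * (V T * C ^ 2) := by
    have : V T * C ^ 2 = C ^ 2 * V T :=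
      ((show Commute (V T) C from hV.commute_cesaro hC T).pow_right 2).eq
    rw [this, mul_assoc, this]
  rw [hcomm] at hQ
  have hi := hV.cesaro_injective hC
  ext g
  have h1 := congrArg (fun A : H →L[ℂ] H => A g) hQ
  simp only [pow_two, mul_apply_eq_comp] at h1 ⊢
  exact (hi (hi h1)).symm

/-- The operator `∫_0^∞ k(t) V t dt` is the function `∫_0^∞ k(t) e^{-t/z} dt` of `C`. -/
lemma eq_cfc_of_isLaplace [TopologicalSpace.SeparableSpace H] {k : ℝ → ℂ} {T : H →L[ℂ] H}
    (hT : IsLaplace V k T)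
    (hk : IntegrableOn (fun t => k t * (Real.exp (-t / 2) : ℂ)) (Set.Ioi 0)) {φ : ℂ → ℂ}
    (hφ : ContinuousOn φ (spectrum ℂ C))
    (hφk : ∀ z ∈ spectrum ℂ C, z ≠ 0 →
      ∫ t in Set.Ioi (0 : ℝ), k t * Complex.exp (-t / z) = φ z) : T = cfc φ C := by
  have hN := hV.isStarNormal_cesaro hC
  have hσ : spectrum ℂ C ⊆ {z | ‖z - 1‖ = 1} := fun z hz => hV.spectrum_cesaro_subset hC hz
  set F : ℝ → C(spectrum ℂ C, ℂ) := fun t => ⟨fun z => expSymbol t z,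
    continuousOn_iff_continuous_domRestrict.1 ((continuousOn_expSymbol_right t).mono hσ)⟩ with hF
  have hFc : Continuous F := by
    refine ContinuousMap.continuous_of_continuous_uncurry _ ?_
    have := continuousOn_expSymbol.comp_continuous
      (f := fun p : ℝ × spectrum ℂ C => (p.1, (p.2 : ℂ))) (by fun_prop) (fun p => hσ p.2.2)
    exact this
  have hFn : ∀ t, ‖F t‖ ≤ Real.exp (-t / 2) * 4 := fun t => by
    refine (ContinuousMap.norm_le _ (by positivity)).2 fun z => ?_
    refine (norm_expSymbol_le (hσ z.2) t).trans ?_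
    have h5 : ‖(z : ℂ)‖ ^ 2 ≤ 2 ^ 2 := by gcongr; exact norm_le_two_of_circle (hσ z.2)
    gcongr
    linarith
  have hkm : AEStronglyMeasurable k (volume.restrict (Set.Ioi 0)) := by
    have h1 : AEStronglyMeasurable (fun t : ℝ => (Real.exp (t / 2) : ℂ))
        (volume.restrict (Set.Ioi 0)) := by fun_prop
    refine (hk.1.mul h1).congr (ae_of_all _ fun t => ?_)
    simp only [Pi.mul_apply]
    rw [mul_assoc, ← Complex.ofReal_mul, ← Real.exp_add]
    ring_nf; simp
  have hint : IntegrableOn (fun t => k t • F t) (Set.Ioi 0) := by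
    refine (hk.norm.mul_const 4).mono' (hkm.smul hFc.aestronglyMeasurable)
      (ae_of_all _ fun t => ?_)
    rw [norm_smul, norm_mul, Complex.norm_real, Real.norm_of_nonneg (Real.exp_pos _).le,
      mul_assoc]
    gcongr
    exact hFn t
  have hL : ∀ t ∈ Set.Ioi (0 : ℝ), cfcL (a := C) hN (F t) = V t * C ^ 2 := fun t ht => by
    rw [hV.apply_mul_sq_eq_cfc hC (le_of_lt ht), cfc_eq_cfcL hN ((continuousOn_expSymbol_right t).mono hσ)]
    rfl
  have h1 : cfcL (a := C) hN (∫ t in Set.Ioi (0 : ℝ), k t • F t) = cfc φ C * C ^ 2 := by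
    have h2 : ContinuousOn (fun z : ℂ => φ z * z ^ 2) (spectrum ℂ C) := hφ.mul (by fun_prop)
    rw [show cfc φ C * C ^ 2 = cfc (fun z => φ z * z ^ 2) C by
      rw [cfc_mul _ _ _ hφ (by fun_prop), cfc_pow_id C], cfc_eq_cfcL hN h2]
    congr 1
    ext z
    rw [ContinuousMap.integral_apply hint]
    simp only [ContinuousMap.smul_apply, hF, ContinuousMap.coe_mk, expSymbol, smul_eq_mul,
      Set.domRestrict_apply]
    simp only [← mul_assoc]
    rw [integral_mul_const]
    rcases eq_or_ne (z : ℂ) 0 with h0 | h0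
    · simp [h0]
    · rw [hφk z z.2 h0]
  have h2 : T * C ^ 2 = cfc φ C * C ^ 2 := by
    rw [← h1, ← ContinuousLinearMap.integral_comp_comm _ hint]
    ext g
    refine ext_inner_left ℂ fun f => ?_
    have hint' : IntegrableOn (fun t => cfcL (a := C) hN (k t • F t)) (Set.Ioi 0) :=
      ContinuousLinearMap.integrable_comp _ hint
    rw [ContinuousLinearMap.integral_apply hint', ← integral_inner
      (hint'.apply_continuousLinearMap g), mul_apply_eq_comp, hT]
    refine setIntegral_congr_fun measurableSet_Ioi fun t ht => ?_
    simp only [map_smul, hL t ht, smul_apply, inner_smul_right, mul_apply_eq_comp]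
  have hdense : DenseRange (C ^ 2 : H →L[ℂ] H) :=
    denseRange_sq_of_isStarNormal hN (hV.cesaro_injective hC)
  refine DFunLike.coe_injective (hdense.equalizer T.continuous (cfc φ C).continuous ?_)
  ext g
  exact congrArg (fun A : H →L[ℂ] H => A g) h2

end IsDilationGroup
end Abstract

section Dilation

lemma norm_toLp_sq {f : ℝ → ℂ} (hf : MemLp f 2 volume) :
    ‖hf.toLp f‖ ^ 2 = ∫ x, ‖f x‖ ^ 2 := by
  have h := inner_self_eq_norm_sq_to_K (𝕜 := ℂ) (hf.toLp f)
  rw [L2.inner_def] at h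
  have h2 : ∫ x, inner ℂ (hf.toLp f x) (hf.toLp f x) = ∫ x, ((‖f x‖ ^ 2 : ℝ) : ℂ) := by
    refine integral_congr_ae ?_
    filter_upwards [hf.coeFn_toLp] with x hx
    rw [hx, inner_self_eq_norm_sq_to_K]
    push_cast; rfl
  rw [h2, integral_complex_ofReal] at h
  simp only [Complex.coe_algebraMap] at h
  exact_mod_cast h.symm

lemma inner_toLp {f g : ℝ → ℂ} (hf : MemLp f 2 volume) (hg : MemLp g 2 volume) :
    inner ℂ (hf.toLp f) (hg.toLp g) = ∫ x, inner ℂ (f x) (g x) := by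
  rw [L2.inner_def]
  refine integral_congr_ae ?_
  filter_upwards [hf.coeFn_toLp, hg.coeFn_toLp] with x h1 h2
  rw [h1, h2]

/-- `x ↦ e^{-t} f(e^{-t} x)`. -/
def dilationFun (t : ℝ) (f : ℝ → ℂ) (x : ℝ) : ℂ := (Real.exp (-t) : ℂ) * f (Real.exp (-t) * x)

lemma dilationFun_congr (t : ℝ) {f g : ℝ → ℂ} (h : f =ᵐ[volume] g) :
    dilationFun t f =ᵐ[volume] dilationFun t g := by
  have hq : Measure.QuasiMeasurePreserving (fun x : ℝ => Real.exp (-t) * x) volume volume := by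
    refine ⟨by fun_prop, ?_⟩
    rw [Real.map_volume_mul_left (Real.exp_pos _).ne']
    exact Measure.smul_absolutelyContinuous
  filter_upwards [hq.ae h] with x hx
  simp only [dilationFun, hx]

lemma memLp_dilationFun (t : ℝ) {f : ℝ → ℂ} (hf : MemLp f 2 volume) :
    MemLp (dilationFun t f) 2 volume := by
  have h : MemLp (fun x => f (Real.exp (-t) * x)) 2 volume := by
    refine MemLp.comp_of_map (f := fun x : ℝ => Real.exp (-t) * x) ?_ (by fun_prop)
    rw [Real.map_volume_mul_left (Real.exp_pos _).ne']
    exact hf.smul_measure (by simp)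
  exact h.const_mul _

lemma inner_dilationFun (t : ℝ) (f g : ℝ → ℂ) :
    ∫ x, inner ℂ (dilationFun t f x) (dilationFun t g x) =
      (Real.exp (-t) : ℂ) * ∫ x, inner ℂ (f x) (g x) := by
  have h1 : ∀ x, inner ℂ (dilationFun t f x) (dilationFun t g x) =
      (Real.exp (-t) : ℂ) ^ 2 * inner ℂ (f (Real.exp (-t) * x)) (g (Real.exp (-t) * x)) := by
    intro x
    simp only [dilationFun, RCLike.inner_apply, map_mul, Complex.conj_ofReal]
    ring
  simp only [h1]
  rw [integral_const_mul, Measure.integral_comp_mul_left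
    (fun y => inner ℂ (f y) (g y)) (Real.exp (-t)), Complex.real_smul,
    abs_of_pos (by positivity)]
  push_cast
  have : Complex.exp (-t) ≠ 0 := Complex.exp_ne_zero _
  field_simp

/-- The dilations `(V t f)(x) = e^{-t} f(e^{-t} x)` of `L²(ℝ)`. -/
def dilation (t : ℝ) : L2R →L[ℂ] L2R :=
  LinearMap.mkContinuous
    { toFun := fun f => (memLp_dilationFun t (Lp.memLp f)).toLp _
      map_add' := fun f g => by
        rw [← MemLp.toLp_add, MemLp.toLp_eq_toLp_iff]
        filter_upwards [dilationFun_congr t (Lp.coeFn_add f g)] with x hx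
        rw [hx]
        simp only [dilationFun, Pi.add_apply]
        ring
      map_smul' := fun c f => by
        rw [RingHom.id_apply, ← MemLp.toLp_const_smul, MemLp.toLp_eq_toLp_iff]
        filter_upwards [dilationFun_congr t (Lp.coeFn_smul c f)] with x hx
        rw [hx]
        simp only [dilationFun, Pi.smul_apply, smul_eq_mul]
        ring }
    (Real.exp (-t / 2))
    fun f => by
      simp only [LinearMap.coe_mk, AddHom.coe_mk]
      have h := inner_toLp (memLp_dilationFun t (Lp.memLp f)) (memLp_dilationFun t (Lp.memLp f))
      rw [inner_dilationFun, ← L2.inner_def, inner_self_eq_norm_sq_to_K,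
        inner_self_eq_norm_sq_to_K] at h
      have h' : ‖(memLp_dilationFun t (Lp.memLp f)).toLp _‖ ^ 2 = Real.exp (-t) * ‖f‖ ^ 2 := by
        simp only [Complex.coe_algebraMap] at h
        exact_mod_cast h
      refine le_of_sq_le_sq ?_ (by positivity)
      rw [h', mul_pow, ← Real.exp_nat_mul]
      apply le_of_eq
      congr 2
      push_cast; ring

lemma dilation_apply (t : ℝ) (f : L2R) : dilation t f =ᵐ[volume] dilationFun t f :=
  MemLp.coeFn_toLp (memLp_dilationFun t (Lp.memLp f))

lemma inner_dilation_dilation (t : ℝ) (f g : L2R) :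
    inner ℂ (dilation t f) (dilation t g) = (Real.exp (-t) : ℂ) * inner ℂ f g := by
  refine (inner_toLp (memLp_dilationFun t (Lp.memLp f)) (memLp_dilationFun t (Lp.memLp g))).trans ?_
  rw [inner_dilationFun, L2.inner_def]

lemma inner_dilation (t : ℝ) (f g : L2R) :
    inner ℂ f (dilation t g) =
      (Real.exp (-t) : ℂ) * ∫ x, inner ℂ (f x) (g (Real.exp (-t) * x)) := by
  rw [L2.inner_def, ← integral_const_mul]
  refine integral_congr_ae ?_
  filter_upwards [dilation_apply t g] with x hx
  rw [hx, dilationFun, ← smul_eq_mul, inner_smul_right]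

lemma dilation_add (s t : ℝ) : dilation (s + t) = dilation s * dilation t := by
  ext1 f
  refine Lp.ext ?_
  rw [mul_apply_eq_comp]
  filter_upwards [dilation_apply (s + t) f, dilation_apply s (dilation t f),
    dilationFun_congr s (dilation_apply t f)] with x h1 h2 h3
  rw [h1, h2, h3]
  simp only [dilationFun, neg_add, Real.exp_add]
  push_cast
  rw [← mul_assoc]
  congr 2
  ring

lemma dilation_zero : dilation 0 = 1 := by
  ext1 f
  refine Lp.ext ?_
  filter_upwards [dilation_apply 0 f] with x h1
  rw [h1]
  simp [dilationFun]

lemma star_dilation_mul (t : ℝ) : star (dilation t) * dilation t = (Real.exp (-t) : ℂ) • 1 := by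
  ext1 g
  refine ext_inner_left ℂ fun f => ?_
  rw [mul_apply_eq_comp, inner_star_apply, inner_dilation_dilation, smul_apply, inner_smul_right]
  simp

lemma isDilationGroup_dilation : IsDilationGroup dilation where
  add := dilation_add
  star_mul_self := star_dilation_mul
  mul_star_self t := by
    have h1 : dilation t * dilation (-t) = 1 := by
      rw [← dilation_add, add_neg_cancel, dilation_zero]
    have h2 : star (dilation t) = (Real.exp (-t) : ℂ) • dilation (-t) := by
      calc star (dilation t) = star (dilation t) * (dilation t * dilation (-t)) := by
            rw [h1, mul_one]
        _ = _ := by rw [← mul_assoc, star_dilation_mul, smul_mul_assoc, one_mul]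
    rw [h2, mul_smul_comm, h1]
  measurable f g := by
    simp only [inner_dilation]
    have hf := (Lp.stronglyMeasurable f).measurable
    have hg := (Lp.stronglyMeasurable g).measurable
    have h : StronglyMeasurable fun p : ℝ × ℝ =>
        inner ℂ (f p.2) (g (Real.exp (-p.1) * p.2)) :=
      ((hf.comp measurable_snd).inner (hg.comp (by fun_prop))).stronglyMeasurable
    have h2 := h.integral_prod_right' (ν := volume)
    exact Measurable.mul (by fun_prop) h2.measurable

end Dilation

section Kernel

lemma image_exp_neg_Ioi : (fun v : ℝ => Real.exp (-v)) '' Set.Ioi 0 = Set.Ioo 0 1 := by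
  ext u
  simp only [Set.mem_image, Set.mem_Ioi, Set.mem_Ioo]
  constructor
  · rintro ⟨v, hv, rfl⟩
    exact ⟨Real.exp_pos _, by simpa using hv⟩
  · rintro ⟨h1, h2⟩
    exact ⟨-Real.log u, by simpa using Real.log_neg h1 h2, by simp [Real.exp_log h1]⟩

lemma hasDerivWithinAt_exp_neg (v : ℝ) (s : Set ℝ) :
    HasDerivWithinAt (fun v => Real.exp (-v)) (-Real.exp (-v)) s v := by
  have h := (Real.hasDerivAt_exp (-v)).comp v (hasDerivAt_neg v)
  rw [mul_neg_one] at h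
  exact h.hasDerivWithinAt

lemma isHausdorffKernel_iff {K : ℝ → ℂ} (hK : ∀ u ∉ Set.Ioo (0 : ℝ) 1, K u = 0) :
    IsHausdorffKernel K ↔
      IntegrableOn (fun t => K (Real.exp (-t)) * (Real.exp (-t / 2) : ℂ)) (Set.Ioi 0) := by
  have h1 : (fun u : ℝ => K u * ((|u| ^ (-(1 / 2) : ℝ) : ℝ) : ℂ)) =
      (Set.Ioo (0 : ℝ) 1).indicator (fun u => K u * ((|u| ^ (-(1 / 2) : ℝ) : ℝ) : ℂ)) := by
    ext u
    by_cases hu : u ∈ Set.Ioo (0 : ℝ) 1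
    · rw [Set.indicator_of_mem hu]
    · rw [Set.indicator_of_notMem hu, hK u hu, zero_mul]
  rw [IsHausdorffKernel, h1, integrable_indicator_iff measurableSet_Ioo, ← image_exp_neg_Ioi,
    integrableOn_image_iff_integrableOn_abs_deriv_smul measurableSet_Ioi
      (fun v _ => hasDerivWithinAt_exp_neg v _) (fun a _ b _ hab => by simpa using hab)]
  refine integrableOn_congr_fun (fun t _ => ?_) measurableSet_Ioi
  have h2 : Real.exp (-t) * Real.exp (-t) ^ (-(1 / 2) : ℝ) = Real.exp (-t / 2) := by
    rw [← Real.exp_mul, ← Real.exp_add]; ring_nf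
  rw [abs_neg, Real.abs_exp, Complex.real_smul, ← h2]
  push_cast
  ring

lemma integrable_prod_hausdorff {K : ℝ → ℂ} (hK : IsHausdorffKernel K) (f g : L2R) :
    Integrable (fun p : ℝ × ℝ => inner ℂ (f p.1) (K p.2 * g (p.2 * p.1)))
      (volume.prod volume) := by
  have hf := (Lp.stronglyMeasurable f).measurable
  have hg := (Lp.stronglyMeasurable g).measurable
  have hm : AEStronglyMeasurable (fun p : ℝ × ℝ => K p.2 * g (p.2 * p.1))
      (volume.prod volume) :=
    (hK.aestronglyMeasurable.comp_snd).mul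
      (by fun_prop : Measurable fun p : ℝ × ℝ => g (p.2 * p.1)).aestronglyMeasurable
  have hm' : AEStronglyMeasurable (fun p : ℝ × ℝ => inner ℂ (f p.1) (K p.2 * g (p.2 * p.1)))
      (volume.prod volume) :=
    AEStronglyMeasurable.inner (hf.comp measurable_fst).aestronglyMeasurable hm
  refine ⟨hm', ?_⟩
  rw [hasFiniteIntegral_iff_enorm, lintegral_prod _ hm'.enorm]
  have h1 : ∀ x u, ‖inner ℂ (f x) (K u * g (u * x))‖ₑ = ‖f x‖ₑ * ‖K u * g (u * x)‖ₑ := by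
    intro x u
    rw [RCLike.inner_apply, enorm_mul, mul_comm]
    congr 1
    rw [← ofReal_norm, ← ofReal_norm, RCLike.norm_conj]
  have hmi : AEMeasurable (fun x => ∫⁻ u, ‖K u * g (u * x)‖ₑ) volume :=
    hm.enorm.lintegral_prod_right'
  have h2 : ∀ᵐ x : ℝ, ∫⁻ u, ‖inner ℂ (f x) (K u * g (u * x))‖ₑ =
      ((fun x => ‖f x‖ₑ) * fun x => ∫⁻ u, ‖K u * g (u * x)‖ₑ) x := by
    filter_upwards with x
    simp only [h1, Pi.mul_apply]
    rw [lintegral_const_mul' _ _ (by simp)]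
  rw [lintegral_congr_ae h2]
  refine (ENNReal.lintegral_mul_le_Lp_mul_Lq volume Real.HolderConjugate.two_two
    hf.enorm.aemeasurable hmi).trans_lt ?_
  have e1 : ∫⁻ x, ‖f x‖ₑ ^ (2 : ℝ) < ∞ := by
    simp only [ENNReal.rpow_two]
    rw [← eLpNorm_two_sq]
    exact ENNReal.pow_lt_top (Lp.memLp f).2
  have e2 : ∫⁻ x, (∫⁻ u, ‖K u * g (u * x)‖ₑ) ^ (2 : ℝ) < ∞ := by
    simp only [ENNReal.rpow_two]
    refine (hausdorff_lintegral_le hK hg).trans_lt ?_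
    rw [← eLpNorm_two_sq]
    exact ENNReal.mul_lt_top (ENNReal.pow_lt_top hK.kernelMass_ne_top.lt_top)
      (ENNReal.pow_lt_top (Lp.memLp g).2)
  exact ENNReal.mul_lt_top (ENNReal.rpow_lt_top_of_nonneg (by norm_num) e1.ne)
    (ENNReal.rpow_lt_top_of_nonneg (by norm_num) e2.ne)

lemma isLaplace_hausdorff {K : ℝ → ℂ} (hK : IsHausdorffKernel K)
    (hK0 : ∀ u ∉ Set.Ioo (0 : ℝ) 1, K u = 0) :
    IsLaplace dilation (fun t => K (Real.exp (-t))) (hausdorff K hK) := by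
  intro f g
  have h1 : inner ℂ f (hausdorff K hK g) =
      ∫ x, ∫ u, inner ℂ (f x) (K u * g (u * x)) := by
    rw [L2.inner_def]
    refine integral_congr_ae ?_
    filter_upwards [hausdorff_apply K hK g, integrable_hausdorff hK
      (Lp.stronglyMeasurable g).measurable (Lp.memLp g)] with x hx hi
    rw [hx, integral_inner hi]
  rw [h1, integral_integral_swap (integrable_prod_hausdorff hK f g)]
  have h2 : (fun u => ∫ x, inner ℂ (f x) (K u * g (u * x))) =
      (Set.Ioo (0 : ℝ) 1).indicator fun u => K u * ∫ x, inner ℂ (f x) (g (u * x)) := by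
    ext u
    by_cases hu : u ∈ Set.Ioo (0 : ℝ) 1
    · rw [Set.indicator_of_mem hu, ← integral_const_mul]
      congr 1 with x
      rw [← smul_eq_mul, inner_smul_right]
    · rw [Set.indicator_of_notMem hu]
      simp [hK0 u hu]
  rw [h2, integral_indicator measurableSet_Ioo, ← image_exp_neg_Ioi,
    integral_image_eq_integral_abs_deriv_smul measurableSet_Ioi
      (fun v _ => hasDerivWithinAt_exp_neg v _) (fun a _ b _ hab => by simpa using hab)]
  congr 1 with t
  rw [inner_dilation, abs_neg, Real.abs_exp, Complex.real_smul]
  ring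

lemma isLaplace_holderMean {α : ℝ} (hα : 0 < α) :
    IsLaplace dilation (fun t => holderKernel α (Real.exp (-t))) (holderMean α) := by
  rw [holderMean, dif_pos hα]
  exact isLaplace_hausdorff _ fun u hu => Set.indicator_of_notMem hu _

lemma holderKernel_exp_neg {α t : ℝ} (ht : 0 < t) :
    holderKernel α (Real.exp (-t)) = (((Real.Gamma α)⁻¹ * t ^ (α - 1) : ℝ) : ℂ) := by
  have : Real.exp (-t) ∈ Set.Ioo (0 : ℝ) 1 := ⟨Real.exp_pos _, by simpa using ht⟩
  rw [holderKernel, Set.indicator_of_mem this, one_div, ← Real.exp_neg, Real.log_exp, neg_neg]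

/-- The Cesàro operator. -/
abbrev cesaro : L2R →L[ℂ] L2R := holderMean 1

lemma isLaplace_cesaro : IsLaplace dilation 1 cesaro := by
  intro f g
  rw [isLaplace_holderMean one_pos f g]
  refine setIntegral_congr_fun measurableSet_Ioi fun t ht => ?_
  simp only [holderKernel_exp_neg ht]
  simp

instance : TopologicalSpace.SeparableSpace L2R := by
  have : Fact ((2 : ℝ≥0∞) ≠ ∞) := ⟨by norm_num⟩
  have : SecondCountableTopology L2R := Lp.SecondCountableTopology
  infer_instance

end Kernel

section Spectrum

lemma eq_zero_of_dilation_eq_smul {g : L2R} {c : ℝ → ℂ}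
    (hc : ∀ t, 0 ≤ t → ‖c t‖ = Real.exp (-t / 2))
    (hg : ∀ t, 0 ≤ t → dilation t g = c t • g) : g = 0 := by
  set G : ℝ → ℝ≥0∞ := fun x => ‖g x‖ₑ ^ 2 with hG
  have hGm : Measurable G := ((Lp.stronglyMeasurable g).measurable.enorm).pow_const 2
  have hfin : ∫⁻ x, G x ≠ ∞ := by
    rw [hG, ← eLpNorm_two_sq]
    exact (ENNReal.pow_lt_top (Lp.memLp g).2).ne
  set F : ℝ → ℝ≥0∞ := fun b => ∫⁻ x in Metric.ball 0 b, G x with hF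
  have hinv : ∀ b t : ℝ, 0 ≤ t → F b = F (Real.exp (-t) * b) := by
    intro b t ht
    have he := Real.exp_pos (-t)
    have h1 : ∀ᵐ x : ℝ, ENNReal.ofReal (Real.exp (-t)) * G (Real.exp (-t) * x) = G x := by
      filter_upwards [dilation_apply t g, Lp.coeFn_smul (c t) g] with x h1 h2
      rw [hg t ht, h2, Pi.smul_apply, smul_eq_mul, dilationFun] at h1
      have h3 := congrArg (fun w : ℂ => ‖w‖ₑ ^ 2) h1
      simp only [enorm_mul, mul_pow] at h3
      have h4 : ‖c t‖ₑ ^ 2 = ENNReal.ofReal (Real.exp (-t)) := by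
        rw [← ofReal_norm, hc t ht, ← ENNReal.ofReal_pow (Real.exp_pos _).le, ← Real.exp_nat_mul]
        congr 2; push_cast; ring
      have h5 : ‖(Real.exp (-t) : ℂ)‖ₑ ^ 2 =
          ENNReal.ofReal (Real.exp (-t)) * ENNReal.ofReal (Real.exp (-t)) := by
        rw [← ofReal_norm, Complex.norm_real, Real.norm_of_nonneg he.le, sq]
      rw [h4, h5, mul_assoc] at h3
      exact ((ENNReal.mul_right_inj (by simpa using he) (by simp)).1 h3).symm
    have h2 := lintegral_comp_mul ((Metric.ball 0 (Real.exp (-t) * b)).indicator G)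
      (hGm.indicator measurableSet_ball) he.ne'
    rw [lintegral_indicator measurableSet_ball] at h2
    have h3 : ∀ x, (Metric.ball 0 (Real.exp (-t) * b)).indicator G (Real.exp (-t) * x) =
        (Metric.ball 0 b).indicator (fun x => G (Real.exp (-t) * x)) x := by
      intro x
      have : Real.exp (-t) * x ∈ Metric.ball (0 : ℝ) (Real.exp (-t) * b) ↔
          x ∈ Metric.ball (0 : ℝ) b := by
        simp only [mem_ball_zero_iff, norm_mul, Real.norm_of_nonneg he.le]
        exact mul_lt_mul_iff_right₀ he
      by_cases hx : x ∈ Metric.ball (0 : ℝ) b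
      · rw [Set.indicator_of_mem hx, Set.indicator_of_mem (this.2 hx)]
      · rw [Set.indicator_of_notMem hx, Set.indicator_of_notMem (fun h => hx (this.1 h))]
    simp only [h3] at h2
    rw [lintegral_indicator measurableSet_ball] at h2
    have h4 : F b = ENNReal.ofReal (Real.exp (-t)) *
        ∫⁻ x in Metric.ball 0 b, G (Real.exp (-t) * x) := by
      rw [← lintegral_const_mul _ (by fun_prop)]
      exact lintegral_congr_ae (ae_restrict_of_ae (h1.mono fun x hx => hx.symm))
    rw [h4, h2, ← mul_assoc, ← ENNReal.ofReal_mul he.le, abs_of_pos (inv_pos.2 he),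
      mul_inv_cancel₀ he.ne', ENNReal.ofReal_one, one_mul]
  have hzero : ∀ b : ℝ, F b = 0 := by
    intro b
    have h1 : Tendsto (fun n : ℕ => F (Real.exp (-(n : ℝ)) * b)) atTop (𝓝 0) := by
      refine tendsto_setLIntegral_zero hfin ?_
      have hb : ∀ r : ℝ, (volume : Measure ℝ) (Metric.ball 0 r) = ENNReal.ofReal (2 * r) :=
        fun r => Real.volume_ball 0 r
      refine Tendsto.congr (fun n => (hb _).symm) ?_
      have h2 : Tendsto (fun n : ℕ => 2 * (Real.exp (-(n : ℝ)) * b)) atTop (𝓝 0) := by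
        have := (Real.tendsto_exp_neg_atTop_nhds_zero.comp
          tendsto_natCast_atTop_atTop (α := ℕ)).mul_const b |>.const_mul 2
        simpa using this
      simpa using ENNReal.tendsto_ofReal h2
    have h2 : Tendsto (fun n : ℕ => F (Real.exp (-(n : ℝ)) * b)) atTop (𝓝 (F b)) := by
      refine tendsto_const_nhds.congr fun n => hinv b n (by positivity)
    exact tendsto_nhds_unique h2 h1
  have hae : ∀ n : ℕ, ∀ᵐ x : ℝ, x ∈ Metric.ball (0 : ℝ) n → G x = 0 := fun n => by
    rw [← ae_restrict_iff' measurableSet_ball]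
    exact (lintegral_eq_zero_iff hGm).1 (hzero n)
  refine Lp.ext ?_
  filter_upwards [ae_all_iff.2 hae, Lp.coeFn_zero ℂ 2 (volume : Measure ℝ)] with x hx h0
  obtain ⟨n, hn⟩ := exists_nat_gt ‖x‖
  have := hx n (by simpa using hn)
  rw [h0]
  simpa [hG] using this

/-- `x^{a}` on `(0, 1)`, and zero elsewhere. -/
def truncPow (a : ℂ) : ℝ → ℂ := (Set.Ioo (0 : ℝ) 1).indicator fun x => (x : ℂ) ^ a

/-- `x^{-1}` on `[1, ∞)`, and zero elsewhere. -/
def invTail : ℝ → ℂ := (Set.Ici (1 : ℝ)).indicator fun x => (x : ℂ)⁻¹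

lemma measurable_truncPow (a : ℂ) : Measurable (truncPow a) :=
  Measurable.indicator (by fun_prop) measurableSet_Ioo

lemma norm_sq_truncPow (a : ℂ) :
    (fun x => ‖truncPow a x‖ ^ 2) = (Set.Ioo (0 : ℝ) 1).indicator fun x => x ^ (2 * a.re) := by
  ext x
  by_cases hx : x ∈ Set.Ioo (0 : ℝ) 1
  · rw [Set.indicator_of_mem hx, truncPow, Set.indicator_of_mem hx,
      Complex.norm_cpow_eq_rpow_re_of_pos hx.1, ← Real.rpow_natCast, ← Real.rpow_mul hx.1.le]
    congr 1; push_cast; ring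
  · rw [Set.indicator_of_notMem hx, truncPow, Set.indicator_of_notMem hx]; simp

lemma memLp_truncPow {a : ℂ} (ha : -(1 / 2) < a.re) : MemLp (truncPow a) 2 volume := by
  rw [memLp_two_iff_integrable_sq_norm (measurable_truncPow a).aestronglyMeasurable,
    norm_sq_truncPow, integrable_indicator_iff measurableSet_Ioo,
    intervalIntegral.integrableOn_Ioo_rpow_iff one_pos]
  linarith

lemma norm_toLp_truncPow_sq {a : ℂ} (ha : -(1 / 2) < a.re) :
    ‖(memLp_truncPow ha).toLp _‖ ^ 2 = 1 / (2 * a.re + 1) := by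
  rw [norm_toLp_sq, norm_sq_truncPow, integral_indicator measurableSet_Ioo,
    ← integral_Ioc_eq_integral_Ioo, ← intervalIntegral.integral_of_le zero_le_one,
    integral_rpow (Or.inl (by linarith)), Real.one_rpow, Real.zero_rpow (by linarith), sub_zero]

lemma memLp_invTail : MemLp invTail 2 volume := by
  have hm : Measurable invTail := Measurable.indicator (by fun_prop) measurableSet_Ici
  have h : (fun x => ‖invTail x‖ ^ 2) = (Set.Ici (1 : ℝ)).indicator fun x => x ^ (-2 : ℝ) := by
    ext x
    by_cases hx : x ∈ Set.Ici (1 : ℝ)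
    · have : 0 ≤ x := zero_le_one.trans hx
      rw [Set.indicator_of_mem hx, invTail, Set.indicator_of_mem hx, norm_inv,
        Complex.norm_real, Real.norm_of_nonneg this, Real.rpow_neg this, inv_pow]
      norm_cast
    · rw [Set.indicator_of_notMem hx, invTail, Set.indicator_of_notMem hx]; simp
  rw [memLp_two_iff_integrable_sq_norm hm.aestronglyMeasurable, h,
    integrable_indicator_iff measurableSet_Ici, integrableOn_Ici_iff_integrableOn_Ioi]
  exact integrableOn_Ioi_rpow_of_lt (by norm_num) one_pos

lemma setIntegral_truncPow {a : ℂ} (ha : -(1 / 2) < a.re) {x : ℝ} (hx : x ≠ 0) :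
    ∫ u in Set.Ioo (0 : ℝ) 1, truncPow a (u * x) =
      (a + 1)⁻¹ * (truncPow a x + invTail x) := by
  have ha1 : a + 1 ≠ 0 := by
    intro h
    have := congrArg Complex.re h
    simp at this; linarith
  have hint : ∀ b : ℝ, 0 < b → ∫ u in Set.Ioo (0 : ℝ) b, (u : ℂ) ^ a = b ^ (a + 1) / (a + 1) := by
    intro b hb
    rw [← integral_Ioc_eq_integral_Ioo, ← intervalIntegral.integral_of_le hb.le,
      integral_cpow (Or.inl (by linarith)), Complex.ofReal_zero, Complex.zero_cpow ha1, sub_zero]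
  rcases lt_or_gt_of_ne hx with hx | hx
  · have h1 : ∀ u ∈ Set.Ioo (0 : ℝ) 1, truncPow a (u * x) = 0 := fun u hu => by
      refine Set.indicator_of_notMem (fun h => ?_) _
      have := mul_neg_of_pos_of_neg hu.1 hx
      linarith [h.1]
    rw [setIntegral_congr_fun measurableSet_Ioo h1, truncPow, invTail,
      Set.indicator_of_notMem (fun h => by linarith [h.1]),
      Set.indicator_of_notMem (fun h => by linarith [Set.mem_Ici.1 h])]
    simp
  · have h1 : ∀ u, (Set.Ioo (0 : ℝ) 1).indicator (fun u => truncPow a (u * x)) u =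
        (Set.Ioo (0 : ℝ) (min 1 x⁻¹)).indicator (fun u : ℝ => (u : ℂ) ^ a * (x : ℂ) ^ a) u := by
      intro u
      by_cases hu : u ∈ Set.Ioo (0 : ℝ) (min 1 x⁻¹)
      · have hu1 : u ∈ Set.Ioo (0 : ℝ) 1 := ⟨hu.1, hu.2.trans_le (min_le_left _ _)⟩
        have hux : u * x ∈ Set.Ioo (0 : ℝ) 1 := ⟨mul_pos hu.1 hx, by
          have := hu.2.trans_le (min_le_right _ _)
          rwa [lt_inv_comm₀ hu.1 hx, ← one_div, lt_div_iff₀ hu.1, mul_comm] at this⟩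
        rw [Set.indicator_of_mem hu, Set.indicator_of_mem hu1, truncPow,
          Set.indicator_of_mem hux]
        push_cast
        rw [Complex.mul_cpow_ofReal_nonneg hu.1.le hx.le]
      · rw [Set.indicator_of_notMem hu]
        by_cases hu1 : u ∈ Set.Ioo (0 : ℝ) 1
        · rw [Set.indicator_of_mem hu1, truncPow, Set.indicator_of_notMem]
          intro hux
          refine hu ⟨hu1.1, lt_min hu1.2 ?_⟩
          rw [lt_inv_comm₀ hu1.1 hx, ← one_div, lt_div_iff₀ hu1.1, mul_comm]
          exact hux.2
        · rw [Set.indicator_of_notMem hu1]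
    rw [← integral_indicator measurableSet_Ioo]
    simp only [h1]
    rw [integral_indicator measurableSet_Ioo, integral_mul_const, hint _ (by positivity)]
    by_cases hx1 : x < 1
    · rw [min_eq_left ((one_le_inv₀ hx).2 hx1.le), truncPow, invTail,
        Set.indicator_of_mem (show x ∈ Set.Ioo (0 : ℝ) 1 from ⟨hx, hx1⟩), Set.indicator_of_notMem (fun h => by
          linarith [Set.mem_Ici.1 h])]
      simp only [Complex.ofReal_one, Complex.one_cpow]
      ring
    · have hx1' := not_lt.1 hx1
      rw [min_eq_right (inv_le_one_of_one_le₀ hx1'), truncPow, invTail,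
        Set.indicator_of_notMem (fun h => hx1 h.2), Set.indicator_of_mem (Set.mem_Ici.2 hx1')]
      have hx0 : (x : ℂ) ≠ 0 := by exact_mod_cast hx.ne'
      have h2 : ((x⁻¹ : ℝ) : ℂ) ^ (a + 1) = ((x : ℂ) ^ (a + 1))⁻¹ := by
        push_cast
        rw [Complex.inv_cpow]
        rw [Complex.arg_ofReal_of_nonneg hx.le]
        exact Real.pi_pos.ne
      rw [h2, Complex.cpow_add _ _ hx0, Complex.cpow_one]
      have h3 : (x : ℂ) ^ a ≠ 0 := by simp [Complex.cpow_eq_zero_iff, hx0]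
      field_simp
      ring

lemma cesaro_truncPow {a : ℂ} (ha : -(1 / 2) < a.re) :
    cesaro ((memLp_truncPow ha).toLp _) =
      (a + 1)⁻¹ • ((memLp_truncPow ha).toLp _ + memLp_invTail.toLp _) := by
  refine Lp.ext ?_
  have hcongr : hausdorffFun (holderKernel 1) ((memLp_truncPow ha).toLp (truncPow a))
      =ᵐ[volume] hausdorffFun (holderKernel 1) (truncPow a) :=
    hausdorffFun_congr _ (memLp_truncPow ha).coeFn_toLp
  have h1 : cesaro ((memLp_truncPow ha).toLp _) =ᵐ[volume]
      hausdorffFun (holderKernel 1) ((memLp_truncPow ha).toLp (truncPow a)) := by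
    rw [cesaro, holderMean, dif_pos one_pos]
    exact hausdorff_apply _ _ _
  filter_upwards [h1, hcongr, Lp.coeFn_smul (a + 1)⁻¹
    ((memLp_truncPow ha).toLp _ + memLp_invTail.toLp _),
    Lp.coeFn_add ((memLp_truncPow ha).toLp _) (memLp_invTail.toLp _),
    (memLp_truncPow ha).coeFn_toLp, memLp_invTail.coeFn_toLp,
    show ∀ᵐ x : ℝ, x ≠ 0 by simp [ae_iff]] with x h1 h2 h3 h4 h5 h6 hx
  rw [h1, h2, h3, Pi.smul_apply, h4, Pi.add_apply, h5, h6, smul_eq_mul,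
    ← setIntegral_truncPow ha hx, hausdorffFun, ← integral_indicator measurableSet_Ioo]
  congr 1 with u
  by_cases hu : u ∈ Set.Ioo (0 : ℝ) 1 <;> simp [holderKernel, hu]

lemma mem_spectrum_cesaro {z : ℂ} (hz : ‖z - 1‖ = 1) (h0 : z ≠ 0) : z ∈ spectrum ℂ cesaro := by
  rw [spectrum.mem_iff]
  rintro ⟨U, hU⟩
  set B : L2R →L[ℂ] L2R := ↑U⁻¹ with hB
  have hBU : ∀ g, B ((algebraMap ℂ (L2R →L[ℂ] L2R) z - cesaro) g) = g := fun g => by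
    rw [← hU, ← mul_apply_eq_comp, hB, Units.inv_mul]; rfl
  have hzinv := inv_re_of_circle hz h0
  set h := memLp_invTail.toLp invTail with hh
  have key : ∀ δ : ℝ, 0 < δ → δ * ‖B‖ ≤ 1 / 8 → 1 / (2 * δ) ≤ (4 * ‖B‖ * ‖h‖) ^ 2 := by
    intro δ hδ hδB
    set a : ℂ := z⁻¹ - 1 + δ with ha
    have hare : a.re = -(1 / 2) + δ := by
      simp only [ha, Complex.add_re, Complex.sub_re, Complex.one_re, Complex.ofReal_re, hzinv]
      ring
    have ha' : -(1 / 2) < a.re := by linarith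
    set f := (memLp_truncPow ha').toLp _ with hf
    have ha1 : a + 1 = z⁻¹ + δ := by rw [ha]; ring
    have hre1 : (a + 1).re = 1 / 2 + δ := by
      rw [Complex.add_re, hare, Complex.one_re]; ring
    have hn1 : ‖(a + 1)⁻¹‖ ≤ 2 := by
      rw [norm_inv]
      refine inv_le_of_inv_le₀ (by norm_num) ?_
      calc (2 : ℝ)⁻¹ ≤ (a + 1).re := by rw [hre1]; linarith
        _ ≤ ‖a + 1‖ := Complex.re_le_norm _
    have ha10 : a + 1 ≠ 0 := by
      intro h'
      rw [h', Complex.zero_re] at hre1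
      linarith
    have h1 : (algebraMap ℂ (L2R →L[ℂ] L2R) z - cesaro) f =
        (z - (a + 1)⁻¹) • f - (a + 1)⁻¹ • h := by
      rw [sub_apply, hf, cesaro_truncPow ha', smul_add, sub_smul, Algebra.algebraMap_eq_smul_one]
      simp only [smul_apply, one_apply_eq_self]
      abel
    have h2 : ‖z - (a + 1)⁻¹‖ ≤ 4 * δ := by
      have : z - (a + 1)⁻¹ = z * (a + 1)⁻¹ * δ := by
        have : (δ : ℂ) = (a + 1) - z⁻¹ := by rw [ha1]; ring
        rw [this]
        field_simp
      rw [this, norm_mul, norm_mul, Complex.norm_real, Real.norm_of_nonneg hδ.le]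
      calc _ ≤ (2 * 2) * δ := by gcongr; exact norm_le_two_of_circle hz
        _ = _ := by ring
    have h3 : ‖f‖ ≤ ‖B‖ * (4 * δ * ‖f‖ + 2 * ‖h‖) := by
      calc ‖f‖ = ‖B ((algebraMap ℂ (L2R →L[ℂ] L2R) z - cesaro) f)‖ := by rw [hBU]
        _ ≤ ‖B‖ * ‖(z - (a + 1)⁻¹) • f - (a + 1)⁻¹ • h‖ := by
            rw [h1]; exact B.le_opNorm _
        _ ≤ ‖B‖ * (‖(z - (a + 1)⁻¹) • f‖ + ‖(a + 1)⁻¹ • h‖) := by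
            gcongr; exact norm_sub_le _ _
        _ ≤ _ := by rw [norm_smul, norm_smul]; gcongr
    have h4 : ‖f‖ ≤ 4 * ‖B‖ * ‖h‖ := by
      have : ‖B‖ * (4 * δ * ‖f‖) ≤ ‖f‖ / 2 := by
        nlinarith [norm_nonneg f]
      nlinarith
    have h5 : ‖f‖ ^ 2 = 1 / (2 * δ) := by
      rw [hf, norm_toLp_truncPow_sq ha', hare]; ring_nf
    rw [← h5]
    gcongr
  set M := (4 * ‖B‖ * ‖h‖) ^ 2 with hM
  have hM0 : 0 ≤ M := by positivity
  have hB0 := norm_nonneg B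
  set δ : ℝ := 1 / (8 * (‖B‖ + M + 1)) with hδ
  have hpos : 0 < ‖B‖ + M + 1 := by positivity
  have h1 := key δ (by positivity) (by
    rw [hδ, div_mul_eq_mul_div, one_mul, div_le_div_iff₀ (by positivity) (by norm_num)]
    nlinarith)
  have h2 : 1 / (2 * δ) = 4 * (‖B‖ + M + 1) := by
    rw [hδ]; field_simp; norm_num
  rw [h2] at h1
  linarith

lemma spectrum_cesaro : spectrum ℂ cesaro = {z | ‖z - 1‖ = 1} := by
  refine Set.Subset.antisymm
    (fun z hz => isDilationGroup_dilation.spectrum_cesaro_subset isLaplace_cesaro hz) ?_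
  intro z hz
  rcases eq_or_ne z 0 with rfl | h0
  · have hcl : IsClosed (spectrum ℂ cesaro) := spectrum.isClosed _
    have h1 : Tendsto (fun n : ℕ => 1 - Complex.exp (((n : ℝ) + 1)⁻¹ * Complex.I)) atTop (𝓝 0) := by
      have h2 : Tendsto (fun n : ℕ => (((n : ℝ) + 1)⁻¹ : ℝ)) atTop (𝓝 0) := by
        simpa [one_div] using tendsto_one_div_add_atTop_nhds_zero_nat (𝕜 := ℝ)
      have h3 : Continuous fun t : ℝ => 1 - Complex.exp (t * Complex.I) := by fun_prop
      have h4 := (h3.tendsto 0).comp h2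
      simpa [Function.comp_def] using h4
    refine hcl.mem_of_tendsto h1 (Eventually.of_forall fun n => ?_)
    have hpos : (0 : ℝ) < ((n : ℝ) + 1)⁻¹ := by positivity
    have hle : ((n : ℝ) + 1)⁻¹ ≤ 1 := inv_le_one_of_one_le₀ (by linarith [n.cast_nonneg (α := ℝ)])
    refine mem_spectrum_cesaro ?_ ?_
    · rw [sub_sub_cancel_left, norm_neg, Complex.norm_exp_ofReal_mul_I]
    · rw [sub_ne_zero]
      intro h
      have h5 := congrArg Complex.re h
      rw [Complex.exp_ofReal_mul_I_re, Complex.one_re] at h5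
      have := Real.cos_lt_cos_of_nonneg_of_le_pi le_rfl (by linarith [Real.pi_gt_three]) hpos
      rw [Real.cos_zero] at this
      linarith
  · exact mem_spectrum_cesaro hz h0

end Spectrum

section GammaIntegral

lemma integrableOn_rpow_mul_exp_neg {α b : ℝ} (hα : 0 < α) (hb : 0 < b) :
    IntegrableOn (fun t : ℝ => t ^ (α - 1) * Real.exp (-b * t)) (Set.Ioi 0) := by
  have := integrableOn_rpow_mul_exp_neg_mul_rpow (p := 1) (s := α - 1) (b := b)
    (by linarith) one_pos hb
  simpa using this

lemma norm_rpow_mul_exp {α t : ℝ} (ht : 0 < t) (w : ℂ) :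
    ‖((t ^ (α - 1) : ℝ) : ℂ) * Complex.exp (-t * w)‖ = t ^ (α - 1) * Real.exp (-w.re * t) := by
  rw [norm_mul, Complex.norm_real, Real.norm_of_nonneg (by positivity), Complex.norm_exp,
    ← Complex.ofReal_neg, Complex.re_ofReal_mul]
  ring_nf

lemma differentiableOn_integral_rpow_mul_exp {α : ℝ} (hα : 0 < α) :
    DifferentiableOn ℂ (fun w : ℂ => ∫ t in Set.Ioi (0 : ℝ),
      ((t ^ (α - 1) : ℝ) : ℂ) * Complex.exp (-t * w)) {w | 0 < w.re} := by
  intro w hw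
  have hw' : 0 < w.re := hw
  refine DifferentiableAt.differentiableWithinAt ?_
  have hs : {v : ℂ | w.re / 2 < v.re} ∈ 𝓝 w :=
    (isOpen_lt continuous_const Complex.continuous_re).mem_nhds (by simp; linarith)
  have hmeas : ∀ v : ℂ, AEStronglyMeasurable (fun t : ℝ => ((t ^ (α - 1) : ℝ) : ℂ) *
      Complex.exp (-t * v)) (volume.restrict (Set.Ioi 0)) := fun v =>
    (by fun_prop : Measurable _).aestronglyMeasurable
  refine (hasDerivAt_integral_of_dominated_loc_of_deriv_le (μ := volume.restrict (Set.Ioi 0))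
    (F := fun v t => ((t ^ (α - 1) : ℝ) : ℂ) * Complex.exp (-t * v))
    (F' := fun v t => ((t ^ (α - 1) : ℝ) : ℂ) * (Complex.exp (-t * v) * (-t)))
    (bound := fun t => t ^ (α + 1 - 1) * Real.exp (-(w.re / 2) * t))
    hs (Eventually.of_forall hmeas) ?_ ?_ ?_ ?_ ?_).2.differentiableAt
  · refine (integrableOn_rpow_mul_exp_neg hα hw').mono' (hmeas w) ?_
    filter_upwards [ae_restrict_mem measurableSet_Ioi] with t ht
    exact (norm_rpow_mul_exp ht w).le
  · exact (by fun_prop : Measurable _).aestronglyMeasurable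
  · filter_upwards [ae_restrict_mem measurableSet_Ioi] with t ht v hv
    have ht' : 0 < t := ht
    rw [← mul_assoc, norm_mul, norm_rpow_mul_exp ht, norm_neg, Complex.norm_real,
      Real.norm_of_nonneg ht'.le]
    have h1 : t ^ (α + 1 - 1) = t ^ (α - 1) * t := by
      rw [show α + 1 - 1 = (α - 1) + 1 by ring, Real.rpow_add_one ht'.ne']
    rw [h1]
    have h2 : Real.exp (-v.re * t) ≤ Real.exp (-(w.re / 2) * t) := by
      refine Real.exp_le_exp.2 ?_
      have : w.re / 2 < v.re := hv
      nlinarith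
    have h3 : 0 ≤ t ^ (α - 1) := by positivity
    calc _ = t ^ (α - 1) * t * Real.exp (-v.re * t) := by ring
      _ ≤ _ := by gcongr
  · exact integrableOn_rpow_mul_exp_neg (by linarith) (by linarith)
  · refine ae_of_all _ fun t v _ => ?_
    have h1 : HasDerivAt (fun v : ℂ => -(t : ℂ) * v) (-(t : ℂ)) v := by
      simpa using (hasDerivAt_id v).const_mul (-(t : ℂ))
    exact h1.cexp.const_mul _

lemma integral_rpow_mul_exp_neg_mul {α : ℝ} (hα : 0 < α) {w : ℂ} (hw : 0 < w.re) :
    ∫ t in Set.Ioi (0 : ℝ), ((t ^ (α - 1) : ℝ) : ℂ) * Complex.exp (-t * w) =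
      Complex.Gamma α * w ^ (-α : ℂ) := by
  have hopen : IsOpen {w : ℂ | 0 < w.re} := isOpen_lt continuous_const Complex.continuous_re
  have hf := (differentiableOn_integral_rpow_mul_exp hα).analyticOnNhd hopen
  have hg : AnalyticOnNhd ℂ (fun w : ℂ => Complex.Gamma α * w ^ (-α : ℂ)) {w | 0 < w.re} := by
    refine DifferentiableOn.analyticOnNhd (fun v hv => ?_) hopen
    have hv' : v ∈ Complex.slitPlane := Or.inl hv
    exact ((differentiableAt_id.cpow (differentiableAt_const _) hv').const_mul
      _).differentiableWithinAt
  have hconv : IsPreconnected {w : ℂ | 0 < w.re} :=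
    (convex_halfSpace_re_gt 0).isPreconnected
  have hfreq : ∃ᶠ v in 𝓝[≠] (1 : ℂ), ∫ t in Set.Ioi (0 : ℝ),
      ((t ^ (α - 1) : ℝ) : ℂ) * Complex.exp (-t * v) = Complex.Gamma α * v ^ (-α : ℂ) := by
    have hlim : Tendsto (fun n : ℕ => (((1 + 1 / ((n : ℝ) + 1) : ℝ)) : ℂ)) atTop (𝓝[≠] 1) := by
      refine tendsto_nhdsWithin_iff.2 ⟨?_, Eventually.of_forall fun n => ?_⟩
      · have h1 := (tendsto_one_div_add_atTop_nhds_zero_nat (𝕜 := ℝ)).const_add 1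
        have h2 := (Complex.continuous_ofReal.tendsto _).comp h1
        simpa [Function.comp_def] using h2
      · have h1 : (0 : ℝ) < 1 / ((n : ℝ) + 1) := by positivity
        intro h
        have h2 : (1 + 1 / ((n : ℝ) + 1) : ℝ) = 1 := Complex.ofReal_eq_one.1 h
        linarith
    refine hlim.frequently (Frequently.of_forall fun n => ?_)
    set r : ℝ := 1 + 1 / ((n : ℝ) + 1) with hr
    have hr0 : 0 < r := by positivity
    have h1 := Complex.integral_cpow_mul_exp_neg_mul_Ioi (a := α) (r := r) (by simpa) hr0
    have h2 : (1 / (r : ℂ)) ^ (α : ℂ) = (r : ℂ) ^ (-α : ℂ) := by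
      rw [one_div, Complex.inv_cpow _ _ (by
        rw [Complex.arg_ofReal_of_nonneg hr0.le]; exact Real.pi_pos.ne), Complex.cpow_neg]
    rw [h2] at h1
    rw [mul_comm, ← h1]
    refine setIntegral_congr_fun measurableSet_Ioi fun t ht => ?_
    rw [Complex.ofReal_cpow (le_of_lt ht)]
    push_cast
    congr 2
    ring
  exact hf.eqOn_of_preconnected_of_frequently_eq hg hconv (by simp) hfreq hw

lemma integral_holderKernel {α : ℝ} (hα : 0 < α) {z : ℂ} (hz : 0 < z.re) :
    ∫ t in Set.Ioi (0 : ℝ), (((Real.Gamma α)⁻¹ * t ^ (α - 1) : ℝ) : ℂ) * Complex.exp (-t / z) =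
      z ^ (α : ℂ) := by
  have hz0 : z ≠ 0 := by
    rintro rfl; simp at hz
  have h0 : 0 < (z⁻¹).re := by
    rw [Complex.inv_re]
    exact div_pos hz (Complex.normSq_pos.2 hz0)
  have h1 := integral_rpow_mul_exp_neg_mul hα h0
  have h2 : (z⁻¹) ^ (-α : ℂ) = z ^ (α : ℂ) := by
    rw [Complex.inv_cpow, Complex.cpow_neg, inv_inv]
    intro h
    have := (Complex.arg_eq_pi_iff.1 h).1
    linarith
  rw [h2] at h1
  have h3 : (Complex.Gamma α) ≠ 0 := by
    rw [Complex.Gamma_ofReal]; exact_mod_cast (Real.Gamma_pos_of_pos hα).ne'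
  rw [← mul_right_inj' h3, ← h1, ← integral_const_mul]
  congr 1 with t
  rw [Complex.Gamma_ofReal] at h3 ⊢
  push_cast
  rw [div_eq_mul_inv]
  field_simp

end GammaIntegral

section Symbol

/-- The circle `|z - 1| = 1`. -/
abbrev cesaroCircle : Set ℂ := {z | ‖z - 1‖ = 1}

lemma isCompact_cesaroCircle : IsCompact cesaroCircle := by
  have : cesaroCircle = Metric.sphere 1 1 := by
    ext z; simp
  rw [this]
  exact isCompact_sphere _ _

lemma continuousOn_cpow_circle {α : ℝ} (hα : 0 < α) :
    ContinuousOn (fun z : ℂ => z ^ (α : ℂ)) cesaroCircle := by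
  intro z hz
  refine ContinuousAt.continuousWithinAt ?_
  rcases eq_or_ne z 0 with rfl | h0
  · have h := Complex.continuousAt_cpow_zero_of_re_pos (z := (α : ℂ)) (by simpa)
    exact ContinuousAt.comp (f := fun z : ℂ => (z, (α : ℂ))) h (by fun_prop)
  · have : z ∈ Complex.slitPlane := Or.inl (re_pos_of_circle hz h0)
    exact continuousAt_id.cpow continuousAt_const this

lemma log_re_le_of_circle {z : ℂ} (hz : ‖z - 1‖ = 1) (h0 : z ≠ 0) :
    (Complex.log z).re ≤ Real.log 2 := by
  rw [Complex.log_re]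
  exact Real.log_le_log (norm_pos_iff.2 h0) (norm_le_two_of_circle hz)

lemma norm_exp_sub_exp_le {v w : ℂ} (hv : v.re ≤ Real.log 2) (hw : w.re ≤ Real.log 2) :
    ‖Complex.exp w - Complex.exp v‖ ≤ 2 * ‖w - v‖ := by
  refine (convex_halfSpace_re_le (Real.log 2)).norm_image_sub_le_of_norm_hasDerivWithin_le
    (f := Complex.exp) (f' := Complex.exp) (fun x _ => (Complex.hasDerivAt_exp x).hasDerivWithinAt)
    (fun x hx => ?_) hv hw
  rw [Complex.norm_exp, ← Real.exp_log (two_pos : (0 : ℝ) < 2)]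
  exact Real.exp_le_exp.2 hx

lemma norm_exp_sub_one_le_of_re {w : ℂ} (hw : w.re ≤ Real.log 2) :
    ‖Complex.exp w - 1‖ ≤ 2 * ‖w‖ := by
  have := norm_exp_sub_exp_le (v := 0) (by simpa using Real.log_nonneg one_le_two) hw
  simpa using this

lemma norm_exp_sub_one_sub_le_of_re {w : ℂ} (hw : w.re ≤ Real.log 2) :
    ‖Complex.exp w - 1 - w‖ ≤ 2 * ‖w‖ ^ 2 := by
  have hconv : Convex ℝ ({v : ℂ | v.re ≤ Real.log 2} ∩ Metric.closedBall 0 ‖w‖) :=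
    (convex_halfSpace_re_le (Real.log 2)).inter (convex_closedBall _ _)
  have h := hconv.norm_image_sub_le_of_norm_hasDerivWithin_le
    (f := fun v => Complex.exp v - 1 - v) (f' := fun v => Complex.exp v - 1) (C := 2 * ‖w‖)
    (x := 0) (y := w)
    (fun x _ => (((Complex.hasDerivAt_exp x).sub_const 1).sub (hasDerivAt_id x)).hasDerivWithinAt)
    (fun x hx => (norm_exp_sub_one_le_of_re hx.1).trans (by
      have := hx.2
      rw [mem_closedBall_zero_iff] at this
      gcongr))
    ⟨by simpa using Real.log_nonneg one_le_two, by simp⟩ ⟨hw, by simp⟩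
  simp only [Complex.exp_zero, sub_self, sub_zero] at h
  rw [sq, ← mul_assoc]
  exact h

lemma norm_log_mul_norm_le {z : ℂ} (hz : ‖z - 1‖ = 1) (h0 : z ≠ 0) :
    ‖Complex.log z‖ * ‖z‖ ≤ 6 := by
  have hpos : 0 < ‖z‖ := norm_pos_iff.2 h0
  have h2 := norm_le_two_of_circle hz
  have h3 : |Real.log ‖z‖| * ‖z‖ ≤ 2 := by
    rcases le_total ‖z‖ 1 with h | h
    · have := Real.abs_log_mul_self_lt ‖z‖ hpos h
      rw [abs_mul, abs_of_pos hpos] at this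
      linarith
    · rw [abs_of_nonneg (Real.log_nonneg h)]
      have := Real.log_le_sub_one_of_pos hpos
      nlinarith
  have h4 : |Complex.arg z| ≤ 2 := by
    have h5 := Complex.abs_arg_lt_pi_div_two_iff.2 (Or.inl (re_pos_of_circle hz h0))
    linarith [Real.pi_lt_four]
  have h5 : ‖Complex.log z‖ ≤ |Real.log ‖z‖| + 2 := by
    refine (Complex.norm_le_abs_re_add_abs_im _).trans ?_
    rw [Complex.log_re, Complex.log_im]
    gcongr
  calc _ ≤ (|Real.log ‖z‖| + 2) * ‖z‖ := by gcongr
    _ ≤ 2 + 2 * 2 := by nlinarith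
    _ = 6 := by norm_num

lemma cpow_eq_exp_smul_log {z : ℂ} (h0 : z ≠ 0) (t : ℝ) :
    z ^ (t : ℂ) = Complex.exp (t * Complex.log z) := by
  rw [Complex.cpow_def_of_ne_zero h0, mul_comm]

lemma re_smul_log_le {z : ℂ} (hz : ‖z - 1‖ = 1) (h0 : z ≠ 0) {t : ℝ} (ht : 0 ≤ t) (ht1 : t ≤ 1) :
    ((t : ℂ) * Complex.log z).re ≤ Real.log 2 := by
  rw [Complex.re_ofReal_mul]
  calc _ ≤ t * Real.log 2 := by gcongr; exact log_re_le_of_circle hz h0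
    _ ≤ 1 * Real.log 2 := by gcongr
    _ = _ := one_mul _

lemma norm_cpow_sub_one_le {z : ℂ} (hz : ‖z - 1‖ = 1) (h0 : z ≠ 0) {t : ℝ} (ht : 0 ≤ t)
    (ht1 : t ≤ 1) : ‖z ^ (t : ℂ) - 1‖ ≤ 2 * (t * ‖Complex.log z‖) := by
  have := norm_exp_sub_one_le_of_re (re_smul_log_le hz h0 ht ht1)
  rwa [norm_mul, Complex.norm_real, Real.norm_of_nonneg ht, ← cpow_eq_exp_smul_log h0] at this

lemma norm_cpow_sub_one_sub_le {z : ℂ} (hz : ‖z - 1‖ = 1) (h0 : z ≠ 0) {t : ℝ} (ht : 0 ≤ t)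
    (ht1 : t ≤ 1) :
    ‖z ^ (t : ℂ) - 1 - t * Complex.log z‖ ≤ 2 * (t * ‖Complex.log z‖) ^ 2 := by
  have := norm_exp_sub_one_sub_le_of_re (re_smul_log_le hz h0 ht ht1)
  rwa [norm_mul, Complex.norm_real, Real.norm_of_nonneg ht, ← cpow_eq_exp_smul_log h0] at this

/-- The values of the logarithm on the circle `|z - 1| = 1`, `z ≠ 0`. -/
def logCurve : Set ℂ := {l | ∃ z : ℂ, ‖z - 1‖ = 1 ∧ z ≠ 0 ∧ Complex.log z = l}

/-- The symbol `1 / (l - log z)` of the resolvent, continued by `0` to `z = 0`. -/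
def resolventSymbol (l z : ℂ) : ℂ := if z = 0 then 0 else (l - Complex.log z)⁻¹

lemma resolventSymbol_of_ne {z : ℂ} (l : ℂ) (h0 : z ≠ 0) :
    resolventSymbol l z = (l - Complex.log z)⁻¹ := if_neg h0

lemma sub_log_ne_zero {l z : ℂ} (hl : l ∉ logCurve) (hz : ‖z - 1‖ = 1) (h0 : z ≠ 0) :
    l - Complex.log z ≠ 0 := fun h => hl ⟨z, hz, h0, (sub_eq_zero.1 h).symm⟩

lemma tendsto_resolventSymbol_zero (l : ℂ) : Tendsto (resolventSymbol l) (𝓝 0) (𝓝 0) := by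
  have h1 : Tendsto (fun z : ℂ => ‖l - Complex.log z‖) (𝓝[≠] 0) atTop := by
    have h2 : Tendsto (fun z : ℂ => -Real.log ‖z‖ - ‖l‖) (𝓝[≠] 0) atTop := by
      refine tendsto_atTop_add_const_right _ _ (tendsto_neg_atBot_atTop.comp ?_)
      have h3 : Tendsto (fun z : ℂ => ‖z‖) (𝓝[≠] 0) (𝓝[>] 0) := tendsto_norm_nhdsNE_zero
      exact Real.tendsto_log_nhdsGT_zero.comp h3
    refine tendsto_atTop_mono (fun z => ?_) h2
    have h3 := Complex.abs_re_le_norm (Complex.log z)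
    rw [Complex.log_re] at h3
    have h4 := norm_sub_norm_le (Complex.log z) l
    rw [norm_sub_rev] at h4
    have h5 := neg_le_abs (Real.log ‖z‖)
    linarith
  have h2 : Tendsto (fun z : ℂ => (l - Complex.log z)⁻¹) (𝓝[≠] 0) (𝓝 0) := by
    rw [tendsto_zero_iff_norm_tendsto_zero]
    simp only [norm_inv]
    exact tendsto_inv_atTop_zero.comp h1
  have h3 : Tendsto (resolventSymbol l) (𝓝[≠] 0) (𝓝 0) := by
    refine h2.congr' ?_
    filter_upwards [self_mem_nhdsWithin] with z hz
    exact (resolventSymbol_of_ne l hz).symm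
  have h4 : ContinuousAt (resolventSymbol l) 0 := by
    rw [continuousAt_iff_punctured_nhds]
    simpa [resolventSymbol] using h3
  simpa [ContinuousAt, resolventSymbol] using h4

lemma continuousOn_resolventSymbol {l : ℂ} (hl : l ∉ logCurve) :
    ContinuousOn (resolventSymbol l) cesaroCircle := by
  intro z hz
  refine ContinuousAt.continuousWithinAt ?_
  rcases eq_or_ne z 0 with rfl | h0
  · have := tendsto_resolventSymbol_zero l
    rw [ContinuousAt]
    simpa [resolventSymbol] using this
  · have hs : z ∈ Complex.slitPlane := Or.inl (re_pos_of_circle hz h0)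
    have h1 : ContinuousAt (fun z => (l - Complex.log z)⁻¹) z :=
      (continuousAt_const.sub (continuousAt_clog hs)).inv₀ (sub_log_ne_zero hl hz h0)
    refine h1.congr ?_
    filter_upwards [isOpen_ne.mem_nhds h0] with w hw
    exact (resolventSymbol_of_ne l hw).symm

end Symbol

section Semigroup

lemma isStarNormal_cesaro' : IsStarNormal cesaro :=
  isDilationGroup_dilation.isStarNormal_cesaro isLaplace_cesaro

lemma cesaro_injective' : Function.Injective cesaro :=
  isDilationGroup_dilation.cesaro_injective isLaplace_cesaro

lemma continuousOn_spectrum {φ : ℂ → ℂ} (h : ContinuousOn φ cesaroCircle) :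
    ContinuousOn φ (spectrum ℂ cesaro) := by
  rwa [spectrum_cesaro]

lemma mem_circle {z : ℂ} (hz : z ∈ spectrum ℂ cesaro) : ‖z - 1‖ = 1 := by
  rwa [spectrum_cesaro] at hz

lemma hausdorff_eq_cfc {K : ℝ → ℂ} (hK : IsHausdorffKernel K)
    (hK0 : ∀ u ∉ Set.Ioo (0 : ℝ) 1, K u = 0) {φ : ℂ → ℂ} (hφ : ContinuousOn φ cesaroCircle)
    (hφK : ∀ z : ℂ, ‖z - 1‖ = 1 → z ≠ 0 →
      ∫ t in Set.Ioi (0 : ℝ), K (Real.exp (-t)) * Complex.exp (-t / z) = φ z) :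
    hausdorff K hK = cfc φ cesaro :=
  isDilationGroup_dilation.eq_cfc_of_isLaplace isLaplace_cesaro (isLaplace_hausdorff hK hK0)
    ((isHausdorffKernel_iff hK0).1 hK) (continuousOn_spectrum hφ)
    fun z hz h0 => hφK z (mem_circle hz) h0

lemma holderMean_eq_cfc {α : ℝ} (hα : 0 < α) :
    holderMean α = cfc (fun z : ℂ => z ^ (α : ℂ)) cesaro := by
  rw [holderMean, dif_pos hα]
  refine hausdorff_eq_cfc (K := holderKernel α) _ (fun u hu => Set.indicator_of_notMem hu _)
    (continuousOn_cpow_circle hα) fun z hz h0 => ?_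
  rw [← integral_holderKernel hα (re_pos_of_circle hz h0)]
  refine setIntegral_congr_fun measurableSet_Ioi fun t ht => ?_
  rw [holderKernel_exp_neg ht]

lemma holderMean_zero : holderMean 0 = 1 := dif_neg (lt_irrefl _)

lemma isC0Semigroup_holderMean : IsC0Semigroup holderMean where
  zero := holderMean_zero
  add s t hs ht := by
    rcases hs.eq_or_lt with rfl | hs
    · rw [zero_add, holderMean_zero, one_mul]
    rcases ht.eq_or_lt with rfl | ht
    · rw [add_zero, holderMean_zero, mul_one]
    rw [holderMean_eq_cfc hs, holderMean_eq_cfc ht, holderMean_eq_cfc (add_pos hs ht),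
      ← cfc_mul _ _ _ (continuousOn_spectrum (continuousOn_cpow_circle hs))
        (continuousOn_spectrum (continuousOn_cpow_circle ht))]
    refine cfc_congr fun z _ => ?_
    rcases eq_or_ne z 0 with rfl | h0
    · have h1 : ((s + t : ℝ) : ℂ) ≠ 0 := by exact_mod_cast (add_pos hs ht).ne'
      have h2 : (s : ℂ) ≠ 0 := by exact_mod_cast hs.ne'
      simp only [Complex.zero_cpow h1, Complex.zero_cpow h2, zero_mul]
    · rw [Complex.ofReal_add, Complex.cpow_add _ _ h0]
  tendsto_zero f := by
    have hmem : ∀ᶠ t : ℝ in 𝓝[>] 0, t ∈ Set.Ioc (0 : ℝ) 1 := Ioc_mem_nhdsGT one_pos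
    have h := tendsto_cfc_apply (l := 𝓝[>] (0 : ℝ)) (φ := fun t z => z ^ (t : ℂ))
      (ψ := fun _ => 1) (M := 2) (ε := fun t => 24 * t) isStarNormal_cesaro' cesaro_injective'
      (hmem.mono fun t ht => continuousOn_spectrum (continuousOn_cpow_circle ht.1))
      continuousOn_const
      (hmem.mono fun t ht z hz => by
        rcases eq_or_ne z 0 with rfl | h0
        · have h2 : (t : ℂ) ≠ 0 := by exact_mod_cast ht.1.ne'
          rw [Complex.zero_cpow h2]; simp
        · rw [cpow_eq_exp_smul_log h0, Complex.norm_exp]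
          have := re_smul_log_le (mem_circle hz) h0 ht.1.le ht.2
          calc _ ≤ Real.exp (Real.log 2) := Real.exp_le_exp.2 this
            _ = 2 := Real.exp_log two_pos)
      (by
        have : Tendsto (fun t : ℝ => 24 * t) (𝓝 0) (𝓝 (24 * 0)) :=
          (continuous_const.mul continuous_id).tendsto 0
        rw [mul_zero] at this
        exact this.mono_left nhdsWithin_le_nhds)
      (hmem.mono fun t ht z hz => by
        rcases eq_or_ne z 0 with rfl | h0
        · simpa using ht.1.le
        · have h1 := norm_cpow_sub_one_le (mem_circle hz) h0 ht.1.le ht.2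
          have h2 := norm_log_mul_norm_le (mem_circle hz) h0
          have h3 := norm_le_two_of_circle (mem_circle hz)
          calc _ ≤ 2 * (t * ‖Complex.log z‖) * ‖z‖ ^ 2 := by gcongr
            _ = 2 * t * (‖Complex.log z‖ * ‖z‖) * ‖z‖ := by ring
            _ ≤ 2 * t * 6 * 2 := by
              have := ht.1
              gcongr
            _ = 24 * t := by ring) f
    have h1 : cfc (fun _ : ℂ => (1 : ℂ)) cesaro f = f := by
      have := isStarNormal_cesaro'
      rw [cfc_const_one ℂ cesaro]; rfl
    rw [h1] at h
    refine h.congr' (hmem.mono fun t ht => ?_)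
    simp only [holderMean_eq_cfc ht.1]

/-- The operator `1 / (l - log z)` of the Cesàro operator `z`. -/
def logResolvent (l : ℂ) : L2R →L[ℂ] L2R := cfc (resolventSymbol l) cesaro

lemma tendsto_cfc_quotient {l : ℂ} (hl : l ∉ logCurve) (g : L2R) :
    Tendsto (fun t : ℝ => cfc (fun z : ℂ => (t : ℂ)⁻¹ * (z ^ (t : ℂ) - 1) * resolventSymbol l z)
      cesaro g) (𝓝[>] 0) (𝓝 (l • logResolvent l g - g)) := by
  have hN := isStarNormal_cesaro'
  have hρ := continuousOn_resolventSymbol hl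
  obtain ⟨B, hB⟩ := isCompact_cesaroCircle.exists_bound_of_continuousOn hρ
  have hB0 : 0 ≤ B := (norm_nonneg _).trans (hB 0 (by simp))
  have hmem : ∀ᶠ t : ℝ in 𝓝[>] 0, t ∈ Set.Ioc (0 : ℝ) 1 := Ioc_mem_nhdsGT one_pos
  have hlim : cfc (fun z => l * resolventSymbol l z - 1) cesaro g = l • logResolvent l g - g := by
    rw [cfc_sub (fun z => l * resolventSymbol l z) (fun _ => 1) cesaro
      (continuousOn_spectrum (continuousOn_const.mul hρ)) continuousOn_const,
      cfc_const_mul _ _ _ (continuousOn_spectrum hρ), cfc_const_one ℂ cesaro]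
    rfl
  have hid : ∀ z : ℂ, ‖z - 1‖ = 1 → z ≠ 0 →
      l * resolventSymbol l z - 1 = Complex.log z * resolventSymbol l z := by
    intro z hz h0
    rw [resolventSymbol_of_ne l h0]
    have := sub_log_ne_zero hl hz h0
    field_simp
    ring
  rw [← hlim]
  refine tendsto_cfc_apply (M := 2 * (‖l‖ * B + 1)) (ε := fun t => 72 * B * t) hN cesaro_injective'
    (hmem.mono fun t ht => continuousOn_spectrum ?_) (continuousOn_spectrum ?_)
    (hmem.mono fun t ht z hz => ?_) ?_ (hmem.mono fun t ht z hz => ?_) g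
  · exact (continuousOn_const.mul ((continuousOn_cpow_circle ht.1).sub continuousOn_const)).mul hρ
  · exact (continuousOn_const.mul hρ).sub continuousOn_const
  · have hz := mem_circle hz
    have ht0 := ht.1
    rcases eq_or_ne z 0 with rfl | h0
    · simp only [resolventSymbol, if_true, mul_zero, norm_zero]; positivity
    · have h1 := norm_cpow_sub_one_le hz h0 ht0.le ht.2
      calc _ = t⁻¹ * ‖z ^ (t : ℂ) - 1‖ * ‖resolventSymbol l z‖ := by
            rw [norm_mul, norm_mul, norm_inv, Complex.norm_real, Real.norm_of_nonneg ht0.le]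
        _ ≤ t⁻¹ * (2 * (t * ‖Complex.log z‖)) * ‖resolventSymbol l z‖ := by gcongr
        _ = 2 * ‖Complex.log z * resolventSymbol l z‖ := by
            rw [norm_mul]; field_simp
        _ = 2 * ‖l * resolventSymbol l z - 1‖ := by rw [hid z hz h0]
        _ ≤ 2 * (‖l‖ * B + 1) := by
            gcongr
            refine (norm_sub_le _ _).trans ?_
            rw [norm_mul, norm_one]
            gcongr
            exact hB z hz
  · have : Tendsto (fun t : ℝ => 72 * B * t) (𝓝 0) (𝓝 (72 * B * 0)) :=
      (continuous_const.mul continuous_id).tendsto 0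
    rw [mul_zero] at this
    exact this.mono_left nhdsWithin_le_nhds
  · have hz := mem_circle hz
    have ht0 := ht.1
    rcases eq_or_ne z 0 with rfl | h0
    · simp only [norm_zero, ne_eq, OfNat.ofNat_ne_zero, not_false_eq_true, zero_pow, mul_zero]
      positivity
    · have h1 := norm_cpow_sub_one_sub_le hz h0 ht0.le ht.2
      have h2 := norm_log_mul_norm_le hz h0
      have htc : (t : ℂ) ≠ 0 := by exact_mod_cast ht0.ne'
      have h3 : (t : ℂ)⁻¹ * (z ^ (t : ℂ) - 1) * resolventSymbol l z -
          (l * resolventSymbol l z - 1) =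
          (t : ℂ)⁻¹ * (z ^ (t : ℂ) - 1 - t * Complex.log z) * resolventSymbol l z := by
        rw [hid z hz h0]
        field_simp
      rw [h3, norm_mul, norm_mul, norm_inv, Complex.norm_real, Real.norm_of_nonneg ht0.le]
      calc _ ≤ t⁻¹ * (2 * (t * ‖Complex.log z‖) ^ 2) * B * ‖z‖ ^ 2 := by
            gcongr
            exact hB z hz
        _ = 2 * B * t * (‖Complex.log z‖ * ‖z‖) ^ 2 := by field_simp
        _ ≤ 2 * B * t * 6 ^ 2 := by gcongr
        _ = 72 * B * t := by ring

lemma isResolventAt_logResolvent {l : ℂ} (hl : l ∉ logCurve) :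
    IsResolventAt logCesaro l (logResolvent l) := by
  have hρ := continuousOn_spectrum (continuousOn_resolventSymbol hl)
  have hmem : ∀ᶠ t : ℝ in 𝓝[>] 0, 0 < t := self_mem_nhdsWithin
  have hN := isStarNormal_cesaro'
  have hsplit : ∀ t : ℝ, 0 < t →
      cfc (fun z : ℂ => (t : ℂ)⁻¹ * (z ^ (t : ℂ) - 1) * resolventSymbol l z) cesaro =
        ((t : ℂ)⁻¹ • (holderMean t - 1)) * logResolvent l := by
    intro t ht
    have hc := continuousOn_spectrum (continuousOn_cpow_circle ht)
    rw [cfc_mul (fun z : ℂ => (t : ℂ)⁻¹ * (z ^ (t : ℂ) - 1)) _ cesaro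
      (continuousOn_const.mul (hc.sub continuousOn_const)) hρ,
      cfc_const_mul _ (fun z : ℂ => z ^ (t : ℂ) - 1) cesaro (hc.sub continuousOn_const),
      cfc_sub (fun z : ℂ => z ^ (t : ℂ)) (fun _ => 1) cesaro hc continuousOn_const,
      cfc_const_one ℂ cesaro, ← holderMean_eq_cfc ht]
    rfl
  have hcomm : ∀ t : ℝ, 0 < t →
      ((t : ℂ)⁻¹ • (holderMean t - 1)) * logResolvent l =
        logResolvent l * ((t : ℂ)⁻¹ • (holderMean t - 1)) := by
    intro t ht
    have : Commute (holderMean t) (logResolvent l) := by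
      rw [holderMean_eq_cfc ht]
      exact cfc_commute_cfc _ _ _
    exact ((this.sub_left (Commute.one_left _)).smul_left _).eq
  constructor
  · intro f
    have h1 := ((logResolvent l).continuous.tendsto _).comp (generator_spec holderMean f)
    have h2 := tendsto_cfc_quotient hl (f : L2R)
    have h3 := tendsto_nhds_unique h1 (h2.congr' (hmem.mono fun t ht => by
      rw [hsplit t ht, hcomm t ht]; rfl))
    rw [map_sub, map_smul]
    have h4 : logResolvent l (logCesaro f) = l • logResolvent l (f : L2R) - f := h3
    rw [h4, sub_sub_cancel]
  · intro g
    have h2 : Tendsto (fun t : ℝ => (t : ℂ)⁻¹ • (holderMean t (logResolvent l g) -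
        logResolvent l g)) (𝓝[>] 0) (𝓝 (l • logResolvent l g - g)) :=
      (tendsto_cfc_quotient hl g).congr' (hmem.mono fun t ht => by rw [hsplit t ht]; rfl)
    refine ⟨⟨_, h2⟩, ?_⟩
    have h3 : logCesaro ⟨logResolvent l g, ⟨_, h2⟩⟩ = l • logResolvent l g - g :=
      tendsto_nhds_unique (generator_spec holderMean ⟨logResolvent l g, ⟨_, h2⟩⟩) h2
    rw [h3, sub_sub_cancel]

lemma IsResolventAt.unique {E : Type*} [NormedAddCommGroup E] [NormedSpace ℂ E]
    {A : E →ₗ.[ℂ] E} {z : ℂ} {R R' : E →L[ℂ] E} (h : IsResolventAt A z R)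
    (h' : IsResolventAt A z R') : R = R' := by
  ext g
  obtain ⟨hd, hg⟩ := h.2 g
  have := h'.1 ⟨R g, hd⟩
  rw [hg] at this
  exact this.symm

lemma mem_resolventSet_of_notMem {l : ℂ} (hl : l ∉ logCurve) : l ∈ resolventSet logCesaro :=
  ⟨_, isResolventAt_logResolvent hl⟩

lemma resolventOp_eq {l : ℂ} (hl : l ∉ logCurve) : resolventOp logCesaro l = logResolvent l :=
  (resolventOp_spec (mem_resolventSet_of_notMem hl)).unique (isResolventAt_logResolvent hl)

end Semigroup

section Curve

lemma mem_logCurve_iff {l : ℂ} : l ∈ logCurve ↔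
    ∃ y ∈ Set.Ioo (-(Real.pi / 2)) (Real.pi / 2),
      l = (Real.log (2 * Real.cos y) : ℂ) + Complex.I * y := by
  constructor
  · rintro ⟨z, hz, h0, rfl⟩
    have hpos : 0 < ‖z‖ := norm_pos_iff.2 h0
    have harg := abs_lt.1 (Complex.abs_arg_lt_pi_div_two_iff.2 (Or.inl (re_pos_of_circle hz h0)))
    refine ⟨Complex.arg z, harg, ?_⟩
    have h1 : ‖z‖ = 2 * Real.cos (Complex.arg z) := by
      have h2 := normSq_eq_of_circle hz
      rw [← Complex.norm_mul_cos_arg z] at h2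
      have h3 : ‖z‖ * ‖z‖ = ‖z‖ * (2 * Real.cos (Complex.arg z)) := by linarith
      exact mul_left_cancel₀ hpos.ne' h3
    rw [← h1, Complex.log, mul_comm]
  · rintro ⟨y, hy, rfl⟩
    have hcos : 0 < Real.cos y := Real.cos_pos_of_mem_Ioo hy
    set w : ℂ := (Real.log (2 * Real.cos y) : ℂ) + Complex.I * y with hw
    have him : w.im = y := by simp [hw]
    have hexp : Complex.exp w = 1 + Complex.exp ((2 * y : ℝ) * Complex.I) := by
      rw [hw, Complex.exp_add, ← Complex.ofReal_exp, Real.exp_log (by positivity)]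
      push_cast
      rw [Complex.cos, show (2 : ℂ) * y * Complex.I = y * Complex.I + y * Complex.I by ring,
        Complex.exp_add, mul_comm Complex.I, neg_mul]
      have : Complex.exp (-(y * Complex.I)) * Complex.exp (y * Complex.I) = 1 := by
        rw [← Complex.exp_add]; simp
      linear_combination this
    refine ⟨Complex.exp w, ?_, Complex.exp_ne_zero _, ?_⟩
    · rw [hexp, add_sub_cancel_left, Complex.norm_exp_ofReal_mul_I]
    · refine Complex.log_exp ?_ ?_ <;> rw [him] <;> linarith [hy.1, hy.2, Real.pi_pos]

lemma re_le_of_mem_logCurve {l : ℂ} (hl : l ∈ logCurve) : l.re ≤ Real.log 2 := by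
  obtain ⟨z, hz, h0, rfl⟩ := hl
  exact log_re_le_of_circle hz h0

lemma notMem_logCurve_of_re {l : ℂ} (hl : Real.log 2 < l.re) : l ∉ logCurve :=
  fun h => (re_le_of_mem_logCurve h).not_gt hl

lemma notMem_logCurve_ofReal {l : ℝ} (hl : l ≠ Real.log 2) : (l : ℂ) ∉ logCurve := by
  intro h
  obtain ⟨y, -, hy⟩ := mem_logCurve_iff.1 h
  have h1 := congrArg Complex.im hy
  have h2 := congrArg Complex.re hy
  simp only [Complex.ofReal_im, Complex.add_im, Complex.mul_im, Complex.I_re, Complex.I_im,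
    Complex.ofReal_re, zero_mul, one_mul, zero_add, Complex.add_re, Complex.mul_re, mul_zero,
    sub_zero, add_zero] at h1 h2
  rw [← h1, Real.cos_zero, mul_one] at h2
  exact hl h2

lemma log_two_mem_logCurve : (Real.log 2 : ℂ) ∈ logCurve :=
  mem_logCurve_iff.2 ⟨0, ⟨by linarith [Real.pi_pos], by linarith [Real.pi_pos]⟩, by simp⟩

end Curve

section ContinuousSpectrum

lemma cfc_apply_eq_smul {φ : ℂ → ℂ} (hφ : ContinuousOn φ cesaroCircle) {z₀ w : ℂ} {M : ℝ}
    (hM : 0 ≤ M) (h : ∀ z, ‖z - 1‖ = 1 → ‖φ z - w‖ ≤ M * ‖z - z₀‖) {g : L2R}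
    (hg : cfc (fun z => z - z₀) cesaro g = 0) : cfc φ cesaro g = w • g := by
  have hN := isStarNormal_cesaro'
  have hc := continuousOn_spectrum hφ
  have h1 := norm_cfc_apply_le (C := cesaro) (χ := fun z => φ z - w) (ψ := fun z => z - z₀) hM
    (hc.sub continuousOn_const) (by fun_prop) (fun z hz => h z (mem_circle hz)) g
  rw [hg, norm_zero, mul_zero] at h1
  have h2 : cfc (fun z => φ z - w) cesaro g = cfc φ cesaro g - w • g := by
    rw [cfc_sub φ (fun _ => w) cesaro hc continuousOn_const, cfc_const w cesaro, sub_apply,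
      Algebra.algebraMap_eq_smul_one]
    rfl
  rw [h2] at h1
  exact sub_eq_zero.1 (norm_le_zero_iff.1 h1)

lemma norm_expSymbol_sub_expSymbol_le {z z₀ : ℂ} (hz : ‖z - 1‖ = 1) (hz₀ : ‖z₀ - 1‖ = 1)
    (h0 : z₀ ≠ 0) {t : ℝ} (ht : 0 ≤ t) :
    ‖expSymbol t z - expSymbol t z₀‖ ≤ (4 * t / ‖z₀‖ + 4) * ‖z - z₀‖ := by
  have hp : 0 < ‖z₀‖ := norm_pos_iff.2 h0
  have hz₀2 := norm_le_two_of_circle hz₀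
  have hz2 := norm_le_two_of_circle hz
  rcases eq_or_ne z 0 with rfl | hz0
  · have h1 : Real.exp (-t / 2) ≤ 1 := by rw [Real.exp_le_one_iff]; linarith
    have h2 : 0 ≤ 4 * t / ‖z₀‖ := by positivity
    have h3 := norm_expSymbol_le hz₀ t
    have h4 : expSymbol t 0 = 0 := by simp [expSymbol]
    rw [h4, zero_sub, zero_sub, norm_neg, norm_neg]
    calc _ ≤ 1 * ‖z₀‖ ^ 2 := h3.trans (by gcongr)
      _ ≤ _ := by nlinarith
  · have hre : ∀ {v : ℂ}, ‖v - 1‖ = 1 → v ≠ 0 → (-(t : ℂ) / v).re ≤ Real.log 2 := by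
      intro v hv hv0
      rw [div_eq_mul_inv, ← Complex.ofReal_neg, Complex.re_ofReal_mul, inv_re_of_circle hv hv0]
      linarith [Real.log_nonneg one_le_two]
    have h1 := norm_exp_sub_exp_le (hre hz₀ h0) (hre hz hz0)
    have h2 : -(t : ℂ) / z - -(t : ℂ) / z₀ = t * (z - z₀) / (z * z₀) := by
      field_simp
      ring
    rw [h2, norm_div, norm_mul, norm_mul, Complex.norm_real, Real.norm_of_nonneg ht] at h1
    have h3 : expSymbol t z - expSymbol t z₀ =
        (Complex.exp (-t / z) - Complex.exp (-t / z₀)) * z ^ 2 +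
          Complex.exp (-t / z₀) * ((z + z₀) * (z - z₀)) := by
      simp only [expSymbol]; ring
    have h4 : ‖Complex.exp (-t / z₀)‖ ≤ 1 := by
      rw [norm_exp_neg_div_of_circle hz₀ h0, Real.exp_le_one_iff]; linarith
    have h5 : ‖z + z₀‖ ≤ 4 := (norm_add_le _ _).trans (by linarith)
    have hpz : 0 < ‖z‖ := norm_pos_iff.2 hz0
    rw [h3]
    calc _ ≤ ‖Complex.exp (-t / z) - Complex.exp (-t / z₀)‖ * ‖z‖ ^ 2 +
            ‖Complex.exp (-t / z₀)‖ * (‖z + z₀‖ * ‖z - z₀‖) := by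
          refine (norm_add_le _ _).trans_eq ?_
          rw [norm_mul, norm_mul, norm_mul, norm_pow]
      _ ≤ 2 * (t * ‖z - z₀‖ / (‖z‖ * ‖z₀‖)) * ‖z‖ ^ 2 + 1 * (4 * ‖z - z₀‖) := by gcongr
      _ = 2 * t / ‖z₀‖ * ‖z - z₀‖ * ‖z‖ + 4 * ‖z - z₀‖ := by field_simp
      _ ≤ 2 * t / ‖z₀‖ * ‖z - z₀‖ * 2 + 4 * ‖z - z₀‖ := by gcongr
      _ = _ := by ring

lemma eq_zero_of_cesaro_eigenvector {z₀ : ℂ} (hz₀ : ‖z₀ - 1‖ = 1) (h0 : z₀ ≠ 0) {g : L2R}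
    (hg : cfc (fun z => z - z₀) cesaro g = 0) : g = 0 := by
  have hN := isStarNormal_cesaro'
  have hC : cesaro g = z₀ • g := by
    have := cfc_apply_eq_smul (φ := fun z => z) (by fun_prop) (w := z₀) (M := 1) zero_le_one
      (fun z _ => by rw [one_mul]) hg
    rwa [cfc_id' ℂ cesaro] at this
  refine eq_zero_of_dilation_eq_smul (c := fun t => Complex.exp (-t / z₀))
    (fun t _ => norm_exp_neg_div_of_circle hz₀ h0 t) fun t ht => ?_
  have h1 := cfc_apply_eq_smul (continuousOn_expSymbol_right t) (by positivity)
    (fun z hz => norm_expSymbol_sub_expSymbol_le hz hz₀ h0 ht) hg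
  rw [← isDilationGroup_dilation.apply_mul_sq_eq_cfc isLaplace_cesaro ht, pow_two] at h1
  simp only [mul_apply_eq_comp, hC, map_smul, expSymbol] at h1
  have hz2 : z₀ * z₀ ≠ 0 := mul_ne_zero h0 h0
  refine smul_right_injective _ hz2 ?_
  simp only [mul_smul]
  rw [h1, smul_smul, smul_smul]
  congr 1
  ring

/-- The symbol of `(l - log 𝒞) R(l', log 𝒞)`. -/
def quotientSymbol (l l' z : ℂ) : ℂ := 1 + (l - l') * resolventSymbol l' z

lemma quotientSymbol_of_ne {l' z : ℂ} (l : ℂ) (hl' : l' ∉ logCurve) (hz : ‖z - 1‖ = 1)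
    (h0 : z ≠ 0) : quotientSymbol l l' z = (l - Complex.log z) / (l' - Complex.log z) := by
  rw [quotientSymbol, resolventSymbol_of_ne l' h0]
  have := sub_log_ne_zero hl' hz h0
  field_simp
  ring

lemma continuousOn_quotientSymbol (l : ℂ) {l' : ℂ} (hl' : l' ∉ logCurve) :
    ContinuousOn (quotientSymbol l l') cesaroCircle :=
  continuousOn_const.add (continuousOn_const.mul (continuousOn_resolventSymbol hl'))

lemma norm_sub_le_quotientSymbol {z z₀ l' : ℂ} (hl' : l' ∉ logCurve) (hz : ‖z - 1‖ = 1)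
    (hz₀ : ‖z₀ - 1‖ = 1) (h0 : z₀ ≠ 0) :
    ‖z - z₀‖ ≤ (2 * ‖l' - Complex.log z₀‖ + 4) * ‖quotientSymbol (Complex.log z₀) l' z‖ := by
  rcases eq_or_ne z 0 with rfl | hz0
  · have h1 : quotientSymbol (Complex.log z₀) l' 0 = 1 := by
      simp [quotientSymbol, resolventSymbol]
    rw [h1, norm_one, mul_one, zero_sub, norm_neg]
    linarith [norm_le_two_of_circle hz₀, norm_nonneg (l' - Complex.log z₀)]
  · have h1 := sub_log_ne_zero hl' hz hz0
    have h1' : 0 < ‖l' - Complex.log z‖ := norm_pos_iff.2 h1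
    rw [quotientSymbol_of_ne _ hl' hz hz0, norm_div, ← mul_div_assoc, le_div_iff₀ h1']
    have h2 := norm_exp_sub_exp_le (log_re_le_of_circle hz₀ h0) (log_re_le_of_circle hz hz0)
    rw [Complex.exp_log h0, Complex.exp_log hz0, norm_sub_rev (Complex.log z)] at h2
    have h3 : ‖l' - Complex.log z‖ ≤ ‖l' - Complex.log z₀‖ + ‖Complex.log z₀ - Complex.log z‖ := by
      refine le_trans (le_of_eq ?_) (norm_add_le _ _)
      congr 1; ring
    have h4 : ‖z - z₀‖ ≤ 4 := (norm_sub_le _ _).trans (by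
      linarith [norm_le_two_of_circle hz₀, norm_le_two_of_circle hz])
    set A := ‖l' - Complex.log z₀‖
    set D := ‖Complex.log z₀ - Complex.log z‖
    have hA : 0 ≤ A := norm_nonneg _
    have hD : 0 ≤ D := norm_nonneg _
    calc _ ≤ ‖z - z₀‖ * (A + D) := by gcongr
      _ = ‖z - z₀‖ * A + ‖z - z₀‖ * D := by ring
      _ ≤ 2 * D * A + 4 * D := by gcongr
      _ = _ := by ring

lemma cfc_quotientSymbol (l : ℂ) {l' : ℂ} (hl' : l' ∉ logCurve) :
    cfc (quotientSymbol l l') cesaro = 1 + (l - l') • logResolvent l' := by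
  have hN := isStarNormal_cesaro'
  have hρ := continuousOn_spectrum (continuousOn_resolventSymbol hl')
  unfold quotientSymbol
  rw [cfc_add cesaro (fun _ => 1) (fun z => (l - l') * resolventSymbol l' z) continuousOn_const
    (continuousOn_const.mul hρ), cfc_const_one ℂ cesaro, cfc_const_mul _ _ _ hρ]
  rfl

lemma logCurve_subset_continuousSpectrum : logCurve ⊆ continuousSpectrum logCesaro := by
  rintro _ ⟨z₀, hz₀, h0, rfl⟩
  set l := Complex.log z₀ with hl
  have hl' : (1 : ℂ) ∉ logCurve := notMem_logCurve_of_re (by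
    rw [Complex.one_re]; linarith [Real.log_two_lt_d9])
  have hN := isStarNormal_cesaro'
  set N : L2R →L[ℂ] L2R := cfc (quotientSymbol l 1) cesaro with hNdef
  have hNn : IsStarNormal N := cfc_predicate _ _
  have hψ := continuousOn_spectrum (continuousOn_quotientSymbol l hl')
  obtain ⟨hR1, hR2⟩ := isResolventAt_logResolvent hl'
  have hinj : Function.Injective N := by
    rw [injective_iff_map_eq_zero]
    intro g hg
    refine eq_zero_of_cesaro_eigenvector hz₀ h0 (norm_le_zero_iff.1 ?_)
    have := norm_cfc_apply_le (C := cesaro) (χ := fun z => z - z₀) (ψ := quotientSymbol l 1)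
      (M := 2 * ‖1 - Complex.log z₀‖ + 4) (by positivity) (by fun_prop) hψ
      (fun z hz => norm_sub_le_quotientSymbol hl' (mem_circle hz) hz₀ h0) g
    rwa [← hNdef, hg, norm_zero, mul_zero] at this
  have hNf : ∀ f : logCesaro.domain, N ((1 : ℂ) • (f : L2R) - logCesaro f) =
      l • (f : L2R) - logCesaro f := by
    intro f
    rw [hNdef, cfc_quotientSymbol l hl', add_apply, smul_apply, hR1 f, one_apply_eq_self, sub_smul]
    abel
  refine ⟨fun f f' hff' => ?_, fun hsurj => ?_, ?_⟩
  · simp only at hff'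
    rw [← hNf, ← hNf] at hff'
    have h1 := hinj hff'
    have h2 := hR1 f
    rw [h1, hR1 f'] at h2
    exact Subtype.ext h2.symm
  · have hNs : Function.Surjective N := fun g => by
      obtain ⟨f, hf⟩ := hsurj g
      exact ⟨_, (hNf f).trans hf⟩
    have hunit : IsUnit N := ContinuousLinearMap.isUnit_iff_bijective.2 ⟨hinj, hNs⟩
    have h1 : (0 : ℂ) ∈ spectrum ℂ N := by
      rw [hNdef, cfc_map_spectrum _ _ hN hψ, spectrum_cesaro]
      refine ⟨z₀, hz₀, ?_⟩
      rw [quotientSymbol_of_ne _ hl' hz₀ h0, ← hl, sub_self, zero_div]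
    exact spectrum.zero_notMem ℂ hunit h1
  · refine (denseRange_of_isStarNormal hNn hinj).mono ?_
    rintro _ ⟨g, rfl⟩
    obtain ⟨hd, hg⟩ := hR2 g
    refine ⟨⟨logResolvent 1 g, hd⟩, ?_⟩
    have := hNf ⟨logResolvent 1 g, hd⟩
    rw [hg] at this
    exact this.symm

lemma continuousSpectrum_subset {E : Type*} [NormedAddCommGroup E] [NormedSpace ℂ E]
    (A : E →ₗ.[ℂ] E) : continuousSpectrum A ⊆ spectrumOf A := by
  rintro z ⟨-, h, -⟩ ⟨R, hR⟩
  refine h fun g => ?_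
  obtain ⟨hd, hg⟩ := hR.2 g
  exact ⟨⟨R g, hd⟩, hg⟩

lemma spectrumOf_logCesaro : spectrumOf logCesaro = logCurve := by
  refine Set.Subset.antisymm (fun l hl => ?_)
    (logCurve_subset_continuousSpectrum.trans (continuousSpectrum_subset _))
  by_contra h
  exact hl (mem_resolventSet_of_notMem h)

lemma continuousSpectrum_logCesaro : continuousSpectrum logCesaro = logCurve :=
  Set.Subset.antisymm ((continuousSpectrum_subset _).trans spectrumOf_logCesaro.subset)
    logCurve_subset_continuousSpectrum

lemma isLUB_re_logCurve : IsLUB (Complex.re '' logCurve) (Real.log 2) := by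
  refine IsGreatest.isLUB ⟨⟨_, log_two_mem_logCurve, Complex.ofReal_re _⟩, ?_⟩
  rintro _ ⟨l, hl, rfl⟩
  exact re_le_of_mem_logCurve hl

lemma spectrum_logResolvent {l : ℂ} (hl : l ∉ logCurve) :
    spectrum ℂ (logResolvent l) =
      Set.range (fun s : ℝ => 1 / (l + Complex.log (1 / 2 - Complex.I * s))) ∪ {0} := by
  have hN := isStarNormal_cesaro'
  have hlog : ∀ w : ℂ, w.re = 1 / 2 → Complex.log w⁻¹ = -Complex.log w := fun w hw =>
    Complex.log_inv _ fun h => by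
      have := (Complex.arg_eq_pi_iff.1 h).1
      rw [hw] at this
      norm_num at this
  rw [logResolvent, cfc_map_spectrum _ _ hN (continuousOn_spectrum (continuousOn_resolventSymbol hl)),
    spectrum_cesaro]
  ext w
  simp only [Set.mem_image, Set.mem_union, Set.mem_range, Set.mem_singleton_iff]
  constructor
  · rintro ⟨z, hz, rfl⟩
    rcases eq_or_ne z 0 with rfl | h0
    · right; simp [resolventSymbol]
    · left
      refine ⟨-(z⁻¹).im, ?_⟩
      have h1 : (1 / 2 - Complex.I * ((-(z⁻¹).im : ℝ) : ℂ)) = z⁻¹ := by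
        have := inv_re_of_circle hz h0
        apply Complex.ext
        · rw [this]; simp
        · simp
      rw [h1, resolventSymbol_of_ne l h0]
      have h2 := hlog z⁻¹ (inv_re_of_circle hz h0)
      rw [inv_inv] at h2
      rw [h2, sub_neg_eq_add, one_div]
  · rintro (⟨s, rfl⟩ | rfl)
    · set v : ℂ := 1 / 2 - Complex.I * s with hv
      have hre : v.re = 1 / 2 := by simp [hv]
      have hv0 : v ≠ 0 := by
        intro h
        rw [h, Complex.zero_re] at hre
        norm_num at hre
      refine ⟨v⁻¹, ?_, ?_⟩
      · have h1 : v⁻¹ - 1 = (1 - v) / v := by field_simp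
        have h2 : (1 - v) = (starRingEnd ℂ) v := by
          apply Complex.ext
          · rw [Complex.sub_re, Complex.conj_re, hre, Complex.one_re]; norm_num
          · simp
        rw [Set.mem_ofPred_eq, h1, h2, norm_div, RCLike.norm_conj, div_self (norm_ne_zero_iff.2 hv0)]
      · rw [resolventSymbol_of_ne l (inv_ne_zero hv0), hlog v hre, sub_neg_eq_add, one_div]
    · exact ⟨0, by simp, by simp [resolventSymbol]⟩

end ContinuousSpectrum

section Norm

lemma norm_logResolvent_le {l : ℂ} {d : ℝ} (hd : 0 < d)
    (h : ∀ z : ℂ, ‖z - 1‖ = 1 → z ≠ 0 → d ≤ ‖l - Complex.log z‖) :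
    ‖logResolvent l‖ ≤ 1 / d := by
  refine norm_cfc_le (by positivity) fun z hz => ?_
  rcases eq_or_ne z 0 with rfl | h0
  · simp only [resolventSymbol, if_true, norm_zero]; positivity
  · rw [resolventSymbol_of_ne l h0, norm_inv, ← one_div]
    have := h z (mem_circle hz) h0
    gcongr

lemma le_norm_logResolvent {l m : ℂ} (hl : l ∉ logCurve) (hm : m ∈ logCurve) :
    1 / ‖l - m‖ ≤ ‖logResolvent l‖ := by
  obtain ⟨z, hz, h0, rfl⟩ := hm
  have := norm_apply_le_norm_cfc (resolventSymbol l) cesaro (x := z) (by rwa [spectrum_cesaro])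
    (continuousOn_spectrum (continuousOn_resolventSymbol hl)) isStarNormal_cesaro'
  rwa [resolventSymbol_of_ne l h0, norm_inv, ← one_div] at this

lemma norm_logResolvent_of_gt {l : ℝ} (hl : Real.log 2 < l) :
    ‖logResolvent l‖ = 1 / (l - Real.log 2) := by
  refine le_antisymm (norm_logResolvent_le (by linarith) fun z hz h0 => ?_) ?_
  · have h1 := log_re_le_of_circle hz h0
    have h2 := Complex.re_le_norm ((l : ℂ) - Complex.log z)
    rw [Complex.sub_re, Complex.ofReal_re] at h2
    linarith
  · have := le_norm_logResolvent (notMem_logCurve_ofReal hl.ne') log_two_mem_logCurve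
    rwa [← Complex.ofReal_sub, Complex.norm_real, Real.norm_of_nonneg (by linarith)] at this

lemma two_div_pi_le_norm_logResolvent {l : ℝ} (hl : l < Real.log 2) :
    2 / Real.pi ≤ ‖logResolvent l‖ := by
  have h1 : Real.exp l / 2 < 1 := by
    have := Real.exp_lt_exp.2 hl
    rw [Real.exp_log two_pos] at this
    linarith
  have h0 : 0 < Real.exp l / 2 := by positivity
  set y := Real.arccos (Real.exp l / 2) with hy
  have hy0 : 0 < y := Real.arccos_pos.2 h1
  have hy1 : y < Real.pi / 2 := Real.arccos_lt_pi_div_two.2 h0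
  have hcos : 2 * Real.cos y = Real.exp l := by
    rw [hy, Real.cos_arccos (by linarith) h1.le]; ring
  have hm : (l : ℂ) + Complex.I * y ∈ logCurve :=
    mem_logCurve_iff.2 ⟨y, ⟨by linarith, hy1⟩, by rw [hcos, Real.log_exp]⟩
  have := le_norm_logResolvent (notMem_logCurve_ofReal hl.ne) hm
  rw [sub_add_cancel_left, norm_neg, norm_mul, Complex.norm_I, one_mul, Complex.norm_real,
    Real.norm_of_nonneg hy0.le] at this
  refine le_trans ?_ this
  rw [div_le_div_iff₀ Real.pi_pos hy0]
  linarith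

lemma tendsto_norm_logResolvent :
    Tendsto (fun l : ℝ => ‖logResolvent l‖) atBot (𝓝 (2 / Real.pi)) := by
  have hpi := Real.pi_pos
  rw [tendsto_order]
  refine ⟨fun a ha => ?_, fun b hb => ?_⟩
  · filter_upwards [eventually_lt_atBot (Real.log 2)] with l hl
    exact ha.trans_le (two_div_pi_le_norm_logResolvent hl)
  · have hb0 : 0 < b := lt_trans (by positivity) hb
    have hbd : 1 / b < Real.pi / 2 := by
      rw [gt_iff_lt, div_lt_iff₀ hpi] at hb
      rw [div_lt_iff₀ hb0]
      linarith
    have hb1 : 0 < 1 / b := by positivity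
    obtain ⟨d, hd1, hd2⟩ := exists_between hbd
    have hd0 : 0 < d := hb1.trans hd1
    have hcd : 0 < Real.cos d := Real.cos_pos_of_mem_Ioo ⟨by linarith, hd2⟩
    filter_upwards [eventually_le_atBot (Real.log (2 * Real.cos d) - d)] with l hl
    have h1 : ‖logResolvent l‖ ≤ 1 / d := by
      refine norm_logResolvent_le hd0 fun z hz h0 => ?_
      obtain ⟨y, hy, hzy⟩ := mem_logCurve_iff.1 ⟨z, hz, h0, rfl⟩
      have hre : (Complex.log z).re = Real.log (2 * Real.cos y) := by rw [hzy]; simp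
      have him : (Complex.log z).im = y := by rw [hzy]; simp
      rcases le_total d |y| with h | h
      · have := Complex.abs_im_le_norm ((l : ℂ) - Complex.log z)
        rw [Complex.sub_im, Complex.ofReal_im, him, zero_sub, abs_neg] at this
        exact h.trans this
      · have h2 : Real.cos d ≤ Real.cos y := by
          rw [← Real.cos_abs y]
          exact Real.cos_le_cos_of_nonneg_of_le_pi (abs_nonneg _) (by linarith) h
        have h3 : Real.log (2 * Real.cos d) ≤ Real.log (2 * Real.cos y) :=
          Real.log_le_log (by positivity) (by linarith)
        have := Complex.abs_re_le_norm ((l : ℂ) - Complex.log z)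
        rw [Complex.sub_re, Complex.ofReal_re, hre] at this
        have h4 := neg_le_abs (l - Real.log (2 * Real.cos y))
        linarith
    refine h1.trans_lt ?_
    rw [div_lt_iff₀ hd0]
    rw [div_lt_iff₀ hb0] at hd1
    linarith

end Norm

section NuKernel

/-- `e^{-l(s-1)} t^{s-1} e^{-t/z} / Γ(s)`. -/
def nuIntegrand (l z : ℂ) (s t : ℝ) : ℂ :=
  Complex.exp (-l * ((s - 1 : ℝ) : ℂ)) *
    ((((Real.Gamma s)⁻¹ * t ^ (s - 1) : ℝ) : ℂ) * Complex.exp (-t / z))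

lemma continuousOn_nuIntegrand (l z : ℂ) :
    ContinuousOn (fun p : ℝ × ℝ => nuIntegrand l z p.1 p.2) (Set.Ioi 0 ×ˢ Set.Ioi 0) := by
  have hΓ : ContinuousOn (fun p : ℝ × ℝ => (Real.Gamma p.1)⁻¹) (Set.Ioi 0 ×ˢ Set.Ioi 0) := by
    refine ContinuousOn.inv₀ ?_ fun p hp => (Real.Gamma_pos_of_pos hp.1).ne'
    refine ContinuousOn.comp (g := Real.Gamma) (t := Set.Ioi 0) (fun s hs => ?_)
      continuousOn_fst fun p hp => hp.1
    refine (Real.differentiableAt_Gamma fun m => ?_).continuousAt.continuousWithinAt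
    have h1 : (0 : ℝ) < s := hs
    have h2 : (0 : ℝ) ≤ m := m.cast_nonneg
    linarith
  have hpow : ContinuousOn (fun p : ℝ × ℝ => p.2 ^ (p.1 - 1)) (Set.Ioi 0 ×ˢ Set.Ioi 0) :=
    ContinuousOn.rpow (by fun_prop) (by fun_prop) fun p hp => Or.inl (ne_of_gt hp.2)
  have h1 : ContinuousOn (fun p : ℝ × ℝ => Complex.exp (-l * ((p.1 - 1 : ℝ) : ℂ)))
      (Set.Ioi 0 ×ˢ Set.Ioi 0) := by fun_prop
  have h2 : ContinuousOn (fun p : ℝ × ℝ => Complex.exp (-(p.2 : ℂ) / z))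
      (Set.Ioi 0 ×ˢ Set.Ioi 0) := by fun_prop
  exact h1.mul ((Complex.continuous_ofReal.comp_continuousOn (hΓ.mul hpow)).mul h2)

lemma norm_nuIntegrand (l : ℂ) {z : ℂ} (hz : ‖z - 1‖ = 1) (h0 : z ≠ 0) {s t : ℝ} (hs : 0 < s)
    (ht : 0 < t) : ‖nuIntegrand l z s t‖ =
      Real.exp (-l.re * (s - 1)) * ((Real.Gamma s)⁻¹ * (t ^ (s - 1) * Real.exp (-(1 / 2) * t))) := by
  have hΓ := Real.Gamma_pos_of_pos hs
  rw [nuIntegrand, norm_mul, norm_mul, norm_exp_neg_div_of_circle hz h0, Complex.norm_real,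
    Real.norm_of_nonneg (by positivity), Complex.norm_exp, Complex.re_mul_ofReal, Complex.neg_re]
  ring_nf

lemma integral_norm_nuIntegrand (l : ℂ) {z : ℂ} (hz : ‖z - 1‖ = 1) (h0 : z ≠ 0) {s : ℝ}
    (hs : 0 < s) : ∫ t in Set.Ioi (0 : ℝ), ‖nuIntegrand l z s t‖ =
      Real.exp l.re * Real.exp ((Real.log 2 - l.re) * s) := by
  have hΓ := Real.Gamma_pos_of_pos hs
  rw [setIntegral_congr_fun measurableSet_Ioi fun t ht => norm_nuIntegrand l hz h0 hs ht,
    integral_const_mul, integral_const_mul]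
  have h1 := Real.integral_rpow_mul_exp_neg_mul_Ioi hs (r := 1 / 2) (by norm_num)
  simp only [neg_mul]
  rw [h1, one_div_one_div, Real.rpow_def_of_pos two_pos, ← mul_assoc (Real.Gamma s)⁻¹,
    mul_comm _ (Real.Gamma s), mul_inv_cancel_left₀ hΓ.ne', ← Real.exp_add, ← Real.exp_add]
  ring_nf

lemma integrable_nuIntegrand {l z : ℂ} (hl : Real.log 2 < l.re) (hz : ‖z - 1‖ = 1) (h0 : z ≠ 0) :
    Integrable (Function.uncurry (nuIntegrand l z))
      ((volume.restrict (Set.Ioi 0)).prod (volume.restrict (Set.Ioi 0))) := by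
  have hm : AEStronglyMeasurable (Function.uncurry (nuIntegrand l z))
      ((volume.restrict (Set.Ioi 0)).prod (volume.restrict (Set.Ioi 0))) := by
    rw [Measure.prod_restrict]
    exact (continuousOn_nuIntegrand l z).aestronglyMeasurable
      (measurableSet_Ioi.prod measurableSet_Ioi)
  rw [integrable_prod_iff hm]
  constructor
  · filter_upwards [ae_restrict_mem measurableSet_Ioi, hm.prodMk_left] with s hs hms
    have h1 := ((integrableOn_rpow_mul_exp_neg hs (b := 1 / 2) (by norm_num)).const_mul
      (Real.Gamma s)⁻¹).const_mul (Real.exp (-l.re * (s - 1)))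
    refine h1.mono' hms ?_
    filter_upwards [ae_restrict_mem measurableSet_Ioi] with t ht
    exact (norm_nuIntegrand l hz h0 hs ht).le
  · have h1 := (integrableOn_exp_mul_Ioi (a := Real.log 2 - l.re) (by linarith) 0).const_mul
      (Real.exp l.re)
    refine h1.congr ?_
    filter_upwards [ae_restrict_mem measurableSet_Ioi] with s hs
    exact (integral_norm_nuIntegrand l hz h0 hs).symm

lemma nuKernel_exp_neg (l : ℂ) {t : ℝ} (ht : 0 < t) (z : ℂ) :
    nuKernel l (Real.exp (-t)) * Complex.exp (-t / z) =
      ∫ s in Set.Ioi (0 : ℝ), nuIntegrand l z s t := by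
  have h1 : Real.exp (-t) ∈ Set.Ioo (0 : ℝ) 1 := ⟨Real.exp_pos _, by simpa using ht⟩
  rw [nuKernel, Set.indicator_of_mem h1, one_div, ← Real.exp_neg, Real.log_exp, neg_neg, nuExp,
    ← integral_mul_const]
  congr 1 with s
  have h2 : Complex.exp ((-l + (Real.log t : ℂ)) * ((s - 1 : ℝ) : ℂ)) =
      Complex.exp (-l * ((s - 1 : ℝ) : ℂ)) * ((t ^ (s - 1) : ℝ) : ℂ) := by
    rw [Real.rpow_def_of_pos ht, add_mul, Complex.exp_add]
    push_cast
    rfl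
  rw [h2, nuIntegrand]
  push_cast
  ring

lemma nuKernel_eq_zero (l : ℂ) : ∀ u ∉ Set.Ioo (0 : ℝ) 1, nuKernel l u = 0 :=
  fun _ hu => Set.indicator_of_notMem hu _

lemma isHausdorffKernel_nuKernel {l : ℂ} (hl : Real.log 2 < l.re) :
    IsHausdorffKernel (nuKernel l) := by
  rw [isHausdorffKernel_iff (nuKernel_eq_zero l)]
  have h := (integrable_nuIntegrand (z := 2) hl (by norm_num) two_ne_zero).integral_prod_right
  refine Integrable.congr h ?_
  filter_upwards [ae_restrict_mem measurableSet_Ioi] with t ht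
  have := nuKernel_exp_neg l ht 2
  simp only [Function.uncurry]
  rw [← this]
  push_cast
  rfl

lemma integral_nuKernel {l z : ℂ} (hl : Real.log 2 < l.re) (hz : ‖z - 1‖ = 1) (h0 : z ≠ 0) :
    ∫ t in Set.Ioi (0 : ℝ), nuKernel l (Real.exp (-t)) * Complex.exp (-t / z) =
      Complex.exp l * resolventSymbol l z := by
  rw [setIntegral_congr_fun measurableSet_Ioi fun t ht => nuKernel_exp_neg l ht z,
    ← integral_integral_swap (integrable_nuIntegrand hl hz h0)]
  have h1 : ∀ s ∈ Set.Ioi (0 : ℝ), ∫ t in Set.Ioi (0 : ℝ), nuIntegrand l z s t =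
      Complex.exp l * Complex.exp ((Complex.log z - l) * s) := by
    intro s hs
    simp only [nuIntegrand]
    rw [integral_const_mul, integral_holderKernel hs (re_pos_of_circle hz h0),
      Complex.cpow_def_of_ne_zero h0, ← Complex.exp_add, ← Complex.exp_add]
    push_cast
    ring_nf
  have hre : (Complex.log z - l).re < 0 := by
    have := log_re_le_of_circle hz h0
    rw [Complex.sub_re]; linarith
  rw [setIntegral_congr_fun measurableSet_Ioi h1, integral_const_mul,
    integral_exp_mul_complex_Ioi hre, resolventSymbol_of_ne l h0]
  simp only [Complex.ofReal_zero, mul_zero, Complex.exp_zero]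
  rw [← neg_sub l, neg_div_neg_eq, one_div]

lemma hausdorff_nuKernel {l : ℂ} (hl : Real.log 2 < l.re) :
    hausdorff (nuKernel l) (isHausdorffKernel_nuKernel hl) = Complex.exp l • logResolvent l := by
  have hρ := continuousOn_resolventSymbol (notMem_logCurve_of_re hl)
  rw [hausdorff_eq_cfc (φ := fun z => Complex.exp l * resolventSymbol l z) _ (nuKernel_eq_zero l)
    (continuousOn_const.mul hρ) fun z hz h0 => integral_nuKernel hl hz h0,
    cfc_const_mul _ _ _ (continuousOn_spectrum hρ)]
  rfl

lemma logResolvent_apply {l : ℂ} (hl : Real.log 2 < l.re) (f : L2R) :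
    ∀ᵐ x : ℝ, IntegrableOn (fun u : ℝ => nuKernel l u * f (u * x)) (Set.Ioo 0 1) ∧
      logResolvent l f x =
        Complex.exp (-l) * ∫ u in Set.Ioo (0 : ℝ) 1, nuKernel l u * f (u * x) := by
  have hK := isHausdorffKernel_nuKernel hl
  have h1 : logResolvent l f = Complex.exp (-l) • hausdorff (nuKernel l) hK f := by
    rw [hausdorff_nuKernel hl, smul_apply, smul_smul, ← Complex.exp_add, neg_add_cancel,
      Complex.exp_zero, one_smul]
  rw [h1]
  filter_upwards [integrable_hausdorff hK (Lp.stronglyMeasurable f).measurable (Lp.memLp f),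
    hausdorff_apply (nuKernel l) hK f,
    Lp.coeFn_smul (Complex.exp (-l)) (hausdorff (nuKernel l) hK f)] with x hi h2 h3
  refine ⟨hi.integrableOn, ?_⟩
  rw [h3, Pi.smul_apply, h2, smul_eq_mul, setIntegral_eq_integral_of_forall_compl_eq_zero]
  intro u hu
  rw [nuKernel_eq_zero l u hu, zero_mul]

end NuKernel

end

end CesaroLog

theorem mainTheorem3 :
    -- the Hölder means form a strongly continuous semigroup (`logCesaro` is its generator)
    CesaroLog.IsC0Semigroup CesaroLog.holderMean ∧
    -- (i)
    (∀ z : ℂ, Real.log 2 < z.re →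
      z ∈ CesaroLog.resolventSet CesaroLog.logCesaro ∧
      CesaroLog.IsHausdorffKernel (CesaroLog.nuKernel z) ∧
      ∀ f : CesaroLog.L2R, ∀ᵐ x : ℝ,
        IntegrableOn (fun u : ℝ => CesaroLog.nuKernel z u * f (u * x)) (Set.Ioo 0 1) ∧
        CesaroLog.resolventOp CesaroLog.logCesaro z f x =
          Complex.exp (-z) * ∫ u in Set.Ioo (0 : ℝ) 1, CesaroLog.nuKernel z u * f (u * x)) ∧
    -- (ii)
    (∀ z : ℂ, Real.log 2 < z.re →
      spectrum ℂ (CesaroLog.resolventOp CesaroLog.logCesaro z) =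
        Set.range (fun s : ℝ => 1 / (z + Complex.log (1 / 2 - Complex.I * s))) ∪ {0}) ∧
    -- (iii)
    (CesaroLog.spectrumOf CesaroLog.logCesaro =
        CesaroLog.continuousSpectrum CesaroLog.logCesaro ∧
      CesaroLog.spectrumOf CesaroLog.logCesaro =
        {z : ℂ | ∃ y ∈ Set.Ioo (-(Real.pi / 2)) (Real.pi / 2),
          z = (Real.log (2 * Real.cos y) : ℂ) + Complex.I * y} ∧
      IsLUB (Complex.re '' CesaroLog.spectrumOf CesaroLog.logCesaro) (Real.log 2)) ∧
    -- (iv)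
    ((∀ l : ℝ, l ≠ Real.log 2 →
        (l : ℂ) ∈ CesaroLog.resolventSet CesaroLog.logCesaro) ∧
      (∀ l : ℝ, Real.log 2 < l →
        ‖CesaroLog.resolventOp CesaroLog.logCesaro (l : ℂ)‖ = 1 / (l - Real.log 2)) ∧
      Tendsto (fun l : ℝ => ‖CesaroLog.resolventOp CesaroLog.logCesaro (l : ℂ)‖) atBot
        (𝓝 (2 / Real.pi))) := by
  refine ⟨CesaroLog.isC0Semigroup_holderMean, fun z hz => ?_, fun z hz => ?_, ?_, ?_, ?_, ?_⟩
  · have hl := CesaroLog.notMem_logCurve_of_re hz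
    refine ⟨CesaroLog.mem_resolventSet_of_notMem hl, CesaroLog.isHausdorffKernel_nuKernel hz,
      fun f => ?_⟩
    rw [CesaroLog.resolventOp_eq hl]
    exact CesaroLog.logResolvent_apply hz f
  · have hl := CesaroLog.notMem_logCurve_of_re hz
    rw [CesaroLog.resolventOp_eq hl]
    exact CesaroLog.spectrum_logResolvent hl
  · rw [CesaroLog.spectrumOf_logCesaro, CesaroLog.continuousSpectrum_logCesaro]
    exact ⟨rfl, Set.ext fun z => CesaroLog.mem_logCurve_iff, CesaroLog.isLUB_re_logCurve⟩
  · exact fun l hl => CesaroLog.mem_resolventSet_of_notMem (CesaroLog.notMem_logCurve_ofReal hl)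
  · intro l hl
    rw [CesaroLog.resolventOp_eq (CesaroLog.notMem_logCurve_ofReal hl.ne')]
    exact CesaroLog.norm_logResolvent_of_gt hl
  · refine CesaroLog.tendsto_norm_logResolvent.congr' ?_
    filter_upwards [eventually_lt_atBot (Real.log 2)] with l hl
    rw [CesaroLog.resolventOp_eq (CesaroLog.notMem_logCurve_ofReal hl.ne)]
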